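/- Setting. Let $\sigma,\beta:\mathbb R\to\mathbb R$ be continuous with $\sigma>0$. A mollifier is a Schwartz function $\Phi:\mathbb R\to\mathbb R$ with $\int_{\mathbb R}\Phi=1$; put $\Phi_n(x)=n\Phi(nx)$ for integers $n\ge 1$, $\sigma_n^2:=\sigma^2*\Phi_n$, $\beta_n:=\beta*\Phi_n$ and $$L_n g:=\tfrac{\sigma_n^2}{2}g''+\beta_n'g'.$$ Suppose that these convolutions are defined (converge absolutely at every point) for every mollifier, and that the limit $$\Sigma(x)=\lim_{n\to\infty}2\int_0^x\frac{\beta_n'(y)}{\sigma_n^2(y)}\,dy$$ exists, uniformly on compact sets, as a continuous function on $\mathbb R$ that does not depend on the mollifier (on a given compact set, $\sigma_n^2>0$ for all large $n$). For continuous $l:\mathbb R\to\mathbb R$, a function $f\in C^1(\mathbb R)$ is a $C^1$-solution of $Lf=l$ (formally $Lf=\frac{\sigma^2}{2}f''+\beta'f'$) if for every mollifier there are $f_n\in C^2(\mathbb R)$ and continuous $l_n$ with $L_nf_n=l_n$ such that $f_n\to f$, $f_n'\to f'$ and $l_n\to l$ uniformly on compact sets. Let $-\infty<a<b<\infty$,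 $A,B\in\mathbb R$, and let $F:[a,b]\times\mathbb R^2\to\mathbb R$ be continuous. A function $u\in C^1([a,b])$ is a solution of the boundary value problem $$Lu=F(x,u,u'),\qquad u(a)=A,\qquad u(b)=B \tag{1}$$ if there are a continuous extension $\tilde\ell:\mathbb R\to\mathbb R$ of $x\mapsto F(x,u(x),u'(x))$ and an extension $\tilde u\in C^1(\mathbb R)$ of $u$ such that $\tilde u$ is a $C^1$-solution of $L\tilde u=\tilde\ell$ and $\tilde u(a)=A$, $\tilde u(b)=B$. Corollary. Suppose that 1. there is a constant $C$ with $|F(x,y,0)|\le C(1+|y|)$ for all $x\in[a,b]$, $y\in\mathbb R$; 2. $\bigl(F(x,y,z)-F(x,\tilde y,z)\bigr)(y-\tilde y)\ge 0$ for all $x\in[a,b]$, $y,\tilde y,z\in\mathbb R$; 3. there is a constant $k$ with $|F(x,y,z)-F(x,y,\tilde z)|\le k|z-\tilde z|$ for all $x\in[a,b]$, $y,z,\tilde z\in\mathbb R$. Then for all $A,B\in\mathbb R$ there exists exactly one solution $u\in C^1([a,b])$ of the boundary value problem (1). -/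

import Mathlib

open MeasureTheory Set Filter Topology
open scoped SchwartzMap

noncomputable section

namespace DistributionalDrift

/-- A mollifier: a Schwartz function on the real line with integral one. -/
def IsMollifier (Φ : 𝓢(ℝ, ℝ)) : Prop :=
  ∫ x, Φ x = 1

/-- The rescaled mollifier `Φ_n(x) = n Φ(n x)`. -/
def scaled (Φ : 𝓢(ℝ, ℝ)) (n : ℕ) : ℝ → ℝ :=
  fun x => n * Φ (n * x)

/-- The regularization `f ∗ Φ_n`. -/
def mollify (f : ℝ → ℝ) (Φ : 𝓢(ℝ, ℝ)) (n : ℕ) : ℝ → ℝ :=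
  convolution f (scaled Φ n) (ContinuousLinearMap.lsmul ℝ ℝ) volume

/-- The regularized operator `L_n g = (σ_n² / 2) g'' + β_n' g'`, where `σ_n² = σ² ∗ Φ_n` and
`β_n = β ∗ Φ_n`. -/
def regL (σ β : ℝ → ℝ) (Φ : 𝓢(ℝ, ℝ)) (n : ℕ) (g : ℝ → ℝ) : ℝ → ℝ :=
  fun x => mollify (fun y => σ y ^ 2) Φ n x / 2 * deriv (deriv g) x +
    deriv (mollify β Φ n) x * deriv g x

/-- `f` is a `C¹`-solution of `L f = l` on the real line: for every mollifier there are `f_n` of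
class `C²` and continuous `l_n` with `L_n f_n = l_n`, such that `f_n → f` in `C¹` (functions and
derivatives converge uniformly on compacts) and `l_n → l` uniformly on compacts. -/
def IsC1Solution (σ β f l : ℝ → ℝ) : Prop :=
  ContDiff ℝ 1 f ∧ Continuous l ∧
    ∀ Φ : 𝓢(ℝ, ℝ), IsMollifier Φ →
      ∃ (fn ln : ℕ → ℝ → ℝ),
        (∀ n, 1 ≤ n → ContDiff ℝ 2 (fn n) ∧ Continuous (ln n) ∧ regL σ β Φ n (fn n) = ln n) ∧
        TendstoLocallyUniformly fn f atTop ∧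
        TendstoLocallyUniformly (fun n => deriv (fn n)) (deriv f) atTop ∧
        TendstoLocallyUniformly ln l atTop

/-- `Σ_n(x) = 2 ∫_0^x β_n' / σ_n²`. -/
def regSigma (σ β : ℝ → ℝ) (Φ : 𝓢(ℝ, ℝ)) (n : ℕ) : ℝ → ℝ :=
  fun x => 2 * ∫ y in (0 : ℝ)..x, deriv (mollify β Φ n) y / mollify (fun t => σ t ^ 2) Φ n y

/-- The regularizations `σ² ∗ Φ_n` and `β ∗ Φ_n` are defined (the convolution integrals converge
absolutely at every point), for every mollifier. -/
def RegularizationsExist (σ β : ℝ → ℝ) : Prop :=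
  ∀ Φ : 𝓢(ℝ, ℝ), IsMollifier Φ → ∀ n : ℕ, 1 ≤ n →
    ConvolutionExists (fun y => σ y ^ 2) (scaled Φ n) (ContinuousLinearMap.lsmul ℝ ℝ) volume ∧
    ConvolutionExists β (scaled Φ n) (ContinuousLinearMap.lsmul ℝ ℝ) volume

/-- The function `Σ = lim Σ_n` exists in the space of continuous functions (uniform convergence
on compacts), independently of the mollifier. -/
def SigmaExists (σ β : ℝ → ℝ) : Prop :=
  ∃ S : ℝ → ℝ, Continuous S ∧
    ∀ Φ : 𝓢(ℝ, ℝ), IsMollifier Φ →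
      TendstoLocallyUniformly (fun n => regSigma σ β Φ n) S atTop

/-- `u : [a,b] → ℝ` solves the linear boundary value problem `L u = g`, `u(a) = A`, `u(b) = B`:
`g` and `u` have extensions to the real line, continuous resp. of class `C¹`, for which `L u = g`.
Only the values of `u` and `g` on `[a,b]` matter. -/
def IsLinearBVPSolution (σ β : ℝ → ℝ) (a b A B : ℝ) (g u : ℝ → ℝ) : Prop :=
  ∃ gt ut : ℝ → ℝ, EqOn gt g (Icc a b) ∧ EqOn ut u (Icc a b) ∧
    IsC1Solution σ β ut gt ∧ ut a = A ∧ ut b = B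

/-- `u : [a,b] → ℝ` of class `C¹` solves the boundary value problem
`L u = F(x, u, u')`, `u(a) = A`, `u(b) = B`. Only the values of `u` on `[a,b]` matter; its
derivative on `[a,b]` is one-sided at the end points. -/
def IsBVPSolution (σ β : ℝ → ℝ) (a b A B : ℝ) (F : ℝ → ℝ → ℝ → ℝ) (u : ℝ → ℝ) : Prop :=
  ContDiffOn ℝ 1 u (Icc a b) ∧
    IsLinearBVPSolution σ β a b A B (fun x => F x (u x) (derivWithin u (Icc a b) x)) u

end DistributionalDrift

end

noncomputable section

namespace DistributionalDrift

/-! ### Two-point problems for monotone first order systems -/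

/-! Multiplying $L_n f_n = l_n$ by the integrating factor $e^{\Sigma_n}$ removes $\beta_n'$ and
gives $(f_n' e^{\Sigma_n})' = 2 l_n e^{\Sigma_n}/\sigma_n^2$. In the limit, $C^1$-solutions are
exactly the $C^1$ functions with $(f' e^\Sigma)' = 2 l e^\Sigma/\sigma^2$
(`exists_isC1Solution_iff`). This needs smooth mollified coefficients and $\sigma_n^2 \to \sigma^2$
locally uniformly. Both follow from a growth bound: a function whose convolutions with all
mollifiers exist is integrable against some $(1+|t|)^{-N}$ (`exists_integrable_div_pow`).

With $z = u' e^\Sigma$ the boundary value problem becomes the system $u' = e^{-\Sigma} z$, $z' =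
G(x,u,z)$, where $G$ is continuous, nondecreasing in $u$ and Lipschitz in $z$. As $G$ is merely
continuous in $u$, initial value problems may have several solutions, so shooting is done on Euler
schemes. Their terminal value is continuous in the initial slope and grows at a linear rate uniform
in the mesh (`euler_comparison`). The right slopes therefore exist and stay bounded, and a limit of
the schemes solves the system (`exists_system_solution`).

Uniqueness is a maximum principle for the difference of two solutions and the difference of their
fluxes $u' e^\Sigma$ (`nonpos_of_maximum_principle`). -/

/-- The explicit Euler scheme for `u' = r z`, `z' = G(x, u, z)` with `u(a) = A`, `z(a) = s`. -/
def euler (r : ℝ → ℝ) (G : ℝ → ℝ → ℝ → ℝ) (a A h s : ℝ) : ℕ → ℝ × ℝ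
  | 0 => (A, s)
  | k + 1 =>
    ((euler r G a A h s k).1 + h * (r (a + k * h) * (euler r G a A h s k).2),
      (euler r G a A h s k).2 +
        h * G (a + k * h) (euler r G a A h s k).1 (euler r G a A h s k).2)

/-! ### Monotone dependence on the slope and growth of the Euler scheme -/

section Euler

variable {r : ℝ → ℝ} {G : ℝ → ℝ → ℝ → ℝ} {a A h s : ℝ}

theorem continuous_euler (hG : Continuous fun p : ℝ × ℝ × ℝ => G p.1 p.2.1 p.2.2) (k : ℕ) :
    Continuous fun s => euler r G a A h s k := by
  induction k with
  | zero => simp only [euler]; fun_prop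
  | succ k ih =>
    simp only [euler]
    have h1 : Continuous fun s => G (a + k * h) (euler r G a A h s k).1 (euler r G a A h s k).2 :=
      hG.comp (f := fun s => (a + k * h, (euler r G a A h s k).1, (euler r G a A h s k).2))
        (by fun_prop)
    fun_prop

/-- As long as the difference of first components is nonnegative, monotonicity of `G` in `y` can
only raise the difference of second components. The Lipschitz bound in `z` shrinks the latter by at
most the factor `1 - h * K` per step, and `r ≥ r₀` passes it on to the first component. -/
theorem euler_comparison {r₀ K s' : ℝ} (hr₀ : 0 ≤ r₀) (hr : ∀ x, r₀ ≤ r x) (hh : 0 ≤ h)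
    (hK : 0 ≤ K) (hhK : h * K ≤ 1) (hmono : ∀ x y y' z, 0 ≤ (G x y z - G x y' z) * (y - y'))
    (hlip : ∀ x y z z', |G x y z - G x y z'| ≤ K * |z - z'|) (hs : s ≤ s') (k : ℕ) :
    k * h * r₀ * (1 - h * K) ^ k * (s' - s) ≤
        (euler r G a A h s' k).1 - (euler r G a A h s k).1 ∧
      (1 - h * K) ^ k * (s' - s) ≤ (euler r G a A h s' k).2 - (euler r G a A h s k).2 := by
  have hρ0 : 0 ≤ 1 - h * K := by linarith
  have hρ1 : 1 - h * K ≤ 1 := by nlinarith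
  have hδ : 0 ≤ s' - s := by linarith
  induction k with
  | zero => simp [euler]
  | succ k ih =>
    obtain ⟨h1, h2⟩ := ih
    simp only [euler]
    set U' := (euler r G a A h s' k).1
    set U := (euler r G a A h s k).1
    set Z' := (euler r G a A h s' k).2
    set Z := (euler r G a A h s k).2
    set x := a + k * h
    set p := (1 - h * K) ^ k * (s' - s) with hp
    have hp0 : 0 ≤ p := by positivity
    have hkp : k * h * r₀ * (1 - h * K) ^ k * (s' - s) = k * h * r₀ * p := by rw [hp]; ring
    rw [hkp] at h1
    have hU : 0 ≤ U' - U := le_trans (by positivity) h1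
    have hZ : 0 ≤ Z' - Z := le_trans hp0 h2
    have hG1 : 0 ≤ G x U' Z' - G x U Z' := by
      rcases hU.eq_or_lt with h0 | h0
      · rw [show U' = U by linarith]; simp
      · exact nonneg_of_mul_nonneg_left (hmono x U' U Z') h0
    have hG2 : -(K * (Z' - Z)) ≤ G x U Z' - G x U Z := by
      have := neg_le_of_abs_le (hlip x U Z' Z)
      rwa [abs_of_nonneg hZ] at this
    constructor
    · have e1 : ((k + 1 : ℕ) : ℝ) * h * r₀ * (1 - h * K) ^ (k + 1) * (s' - s) =
          (k + 1) * h * r₀ * p * (1 - h * K) := by rw [hp]; push_cast; ring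
      have e2 : (k + 1) * h * r₀ * p * (1 - h * K) ≤ (k + 1) * h * r₀ * p :=
        mul_le_of_le_one_right (by positivity) hρ1
      have e3 : r₀ * p ≤ r x * (Z' - Z) :=
        mul_le_mul (hr x) h2 hp0 (hr₀.trans (hr x))
      have e4 := mul_le_mul_of_nonneg_left e3 hh
      rw [e1]
      linarith
    · have e1 : (1 - h * K) ^ (k + 1) * (s' - s) = (1 - h * K) * p := by rw [hp]; ring
      have e2 : (1 - h * K) * p ≤ (1 - h * K) * (Z' - Z) := mul_le_mul_of_nonneg_left h2 hρ0
      have e3 : h * (-(K * (Z' - Z))) ≤ h * (G x U' Z' - G x U Z) :=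
        mul_le_mul_of_nonneg_left (by linarith) hh
      rw [e1]
      linarith

/-- Discrete Gronwall inequality; the summand `1` absorbs the constant term of the growth bound. -/
theorem euler_bound {r₁ K C : ℝ} (hr₀ : ∀ x, 0 ≤ r x) (hr : ∀ x, r x ≤ r₁) (hh : 0 ≤ h)
    (hK : 0 ≤ K) (hC : 0 ≤ C) (hgrowth : ∀ x y, |G x y 0| ≤ C * (1 + |y|))
    (hlip : ∀ x y z z', |G x y z - G x y z'| ≤ K * |z - z'|) (k : ℕ) :
    |(euler r G a A h s k).1| + |(euler r G a A h s k).2| + 1 ≤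
      (1 + h * (r₁ + C + K)) ^ k * (|A| + |s| + 1) := by
  have hr₁ : 0 ≤ r₁ := (hr₀ 0).trans (hr 0)
  induction k with
  | zero => simp [euler]
  | succ k ih =>
    simp only [euler]
    set U := (euler r G a A h s k).1
    set Z := (euler r G a A h s k).2
    set x := a + k * h
    have h1 : |U + h * (r x * Z)| ≤ |U| + h * (r₁ * |Z|) := by
      refine (abs_add_le _ _).trans ?_
      rw [abs_mul, abs_mul, abs_of_nonneg hh, abs_of_nonneg (hr₀ x)]
      gcongr
      exact hr x
    have h2 : |G x U Z| ≤ C * (1 + |U|) + K * |Z| := by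
      have e1 := hlip x U Z 0
      rw [sub_zero] at e1
      have e2 := hgrowth x U
      have e3 := abs_sub_abs_le_abs_sub (G x U Z) (G x U 0)
      linarith
    have h3 : |Z + h * G x U Z| ≤ |Z| + h * (C * (1 + |U|) + K * |Z|) := by
      refine (abs_add_le _ _).trans ?_
      rw [abs_mul, abs_of_nonneg hh]
      gcongr
    have h4 : (|U| + h * (r₁ * |Z|)) + (|Z| + h * (C * (1 + |U|) + K * |Z|)) + 1 ≤
        (1 + h * (r₁ + C + K)) * (|U| + |Z| + 1) := by
      have e1 : 0 ≤ h * (r₁ * (|U| + 1)) := by positivity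
      have e2 : 0 ≤ h * (C * |Z|) := by positivity
      have e3 : 0 ≤ h * (K * (|U| + 1)) := by positivity
      nlinarith
    calc _ ≤ _ := add_le_add (add_le_add h1 h3) le_rfl
      _ ≤ _ := h4
      _ ≤ (1 + h * (r₁ + C + K)) * ((1 + h * (r₁ + C + K)) ^ k * (|A| + |s| + 1)) := by
        gcongr
      _ = _ := by ring

end Euler

/-! ### Limits of one-step schemes -/

/-- Discrete mean value inequality, which survives the passage to the limit. -/
theorem abs_scheme_sub_le {V φ : ℕ → ℝ} {h g c : ℝ} (hh : 0 ≤ h)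
    (hV : ∀ k, V (k + 1) = V k + h * φ k) {i j : ℕ} (hij : i ≤ j)
    (hφ : ∀ k, i ≤ k → k < j → |φ k - g| ≤ c) :
    |V j - V i - (j - i) * h * g| ≤ c * ((j - i) * h) := by
  induction j, hij using Nat.le_induction with
  | base => simp
  | succ j hij ih =>
    have h1 := ih fun k hk hkj => hφ k hk (hkj.trans (Nat.lt_succ_self _))
    have h2 := hφ j hij (Nat.lt_succ_self _)
    have h3 : h * |φ j - g| ≤ h * c := mul_le_mul_of_nonneg_left h2 hh
    rw [← abs_of_nonneg hh, ← abs_mul, abs_of_nonneg hh] at h3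
    rw [hV]
    push_cast
    calc _ = |(V j - V i - (j - i) * h * g) + h * (φ j - g)| := by congr 1; ring
      _ ≤ _ := abs_add_le _ _
      _ ≤ _ := by linarith

theorem abs_floor_mul_sub_le {t h : ℝ} (ht : 0 ≤ t) (hh : 0 < h) :
    (⌊t / h⌋₊ : ℝ) * h ≤ t ∧ t < ⌊t / h⌋₊ * h + h := by
  have h1 := Nat.floor_le (div_nonneg ht hh.le)
  have h2 := Nat.lt_floor_add_one (t / h)
  rw [le_div_iff₀ hh] at h1
  rw [div_lt_iff₀ hh] at h2
  exact ⟨h1, by linarith⟩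

theorem tendsto_floor_mul {ι : Type*} {l : Filter ι} {h : ι → ℝ} (hpos : ∀ n, 0 < h n)
    (h0 : Tendsto h l (𝓝 0)) {t : ℝ} (ht : 0 ≤ t) :
    Tendsto (fun n => (⌊t / h n⌋₊ : ℝ) * h n) l (𝓝 t) := by
  have h1 : Tendsto (fun n => t - h n) l (𝓝 t) := by simpa using tendsto_const_nhds.sub h0
  refine tendsto_of_tendsto_of_tendsto_of_le_of_le h1 tendsto_const_nhds (fun n => ?_) fun n => ?_
  · have := (abs_floor_mul_sub_le ht (hpos n)).2
    simp only; linarith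
  · exact (abs_floor_mul_sub_le ht (hpos n)).1

/-- A pointwise limit of one-step schemes is differentiable, provided that the slopes of the
schemes converge locally. -/
theorem hasDerivWithinAt_of_scheme {ι : Type*} {l : Filter ι} [NeBot l] {a b : ℝ} {h : ι → ℝ}
    (hpos : ∀ n, 0 < h n) (h0 : Tendsto h l (𝓝 0)) {V φ : ι → ℕ → ℝ}
    (hV : ∀ n k, V n (k + 1) = V n k + h n * φ n k) {v : ℝ → ℝ}
    (hv : ∀ x ∈ Icc a b, Tendsto (fun n => V n ⌊(x - a) / h n⌋₊) l (𝓝 (v x)))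
    {x g : ℝ} (hx : x ∈ Icc a b)
    (hφ : ∀ ε > 0, ∃ δ > 0, ∀ᶠ n in l, ∀ k : ℕ, a + k * h n ≤ b → |a + k * h n - x| ≤ δ →
      |φ n k - g| ≤ ε) :
    HasDerivWithinAt v g (Icc a b) x := by
  rw [hasDerivWithinAt_iff_isLittleO, Asymptotics.isLittleO_iff]
  intro c hc
  obtain ⟨δ, hδ, hφδ⟩ := hφ c hc
  -- Rounding down to a node moves `p` left by less than the mesh, which is eventually below `δ /
  -- 2`; so all nodes involved stay within `δ` of `x`.
  have key : ∀ p ∈ Icc a b, ∀ q ∈ Icc a b, p ≤ q → |p - x| ≤ δ / 2 → |q - x| ≤ δ / 2 →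
      |v q - v p - (q - p) * g| ≤ c * (q - p) := by
    intro p hp q hq hpq hpx hqx
    have hp0 : 0 ≤ p - a := by linarith [hp.1]
    have hq0 : 0 ≤ q - a := by linarith [hq.1]
    have hlim : Tendsto (fun n => ((⌊(q - a) / h n⌋₊ : ℝ) - ⌊(p - a) / h n⌋₊) * h n) l
        (𝓝 (q - p)) := by
      have := (tendsto_floor_mul hpos h0 hq0).sub (tendsto_floor_mul hpos h0 hp0)
      rw [show q - a - (p - a) = q - p by ring] at this
      simpa only [sub_mul] using this
    refine le_of_tendsto_of_tendsto (((hv q hq).sub (hv p hp)).sub (hlim.mul_const g)).abs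
      (hlim.const_mul c) ?_
    filter_upwards [hφδ, h0.eventually (gt_mem_nhds (half_pos hδ))] with n hn hhn
    have hh := hpos n
    refine abs_scheme_sub_le hh.le (hV n) (Nat.floor_mono (by gcongr)) fun k hk hkj => ?_
    have e1 := (abs_floor_mul_sub_le hp0 hh).2
    have e2 := (abs_floor_mul_sub_le hq0 hh).1
    have e3 : (⌊(p - a) / h n⌋₊ : ℝ) * h n ≤ k * h n := by gcongr
    have e4 : (k : ℝ) * h n ≤ (⌊(q - a) / h n⌋₊ : ℝ) * h n := by gcongr
    rw [abs_le] at hpx hqx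
    exact hn k (by linarith [hq.2]) (abs_le.2 ⟨by linarith, by linarith⟩)
  have hnear : ∀ᶠ y in 𝓝[Icc a b] x, |y - x| ≤ δ / 2 := by
    refine eventually_nhdsWithin_of_eventually_nhds ?_
    filter_upwards [Metric.closedBall_mem_nhds x (half_pos hδ)] with y hy
    simpa [Real.dist_eq] using hy
  filter_upwards [hnear, self_mem_nhdsWithin] with y hy hyI
  have hxx : |x - x| ≤ δ / 2 := by simpa using (half_pos hδ).le
  rw [Real.norm_eq_abs, Real.norm_eq_abs, smul_eq_mul]
  rcases le_total x y with hxy | hxy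
  · rw [abs_of_nonneg (sub_nonneg.2 hxy)]
    exact key x hx y hyI hxy hxx hy
  · rw [abs_of_nonpos (sub_nonpos.2 hxy), ← abs_neg]
    convert key y hyI x hx hxy hy hxx using 2 <;> ring

/-- Bounds `(1 - h * K) ^ m` below by a constant that depends only on the product `m * h`. -/
theorem exp_neg_two_mul_le {x : ℝ} (h0 : 0 ≤ x) (h1 : x ≤ 1 / 2) : Real.exp (-(2 * x)) ≤ 1 - x := by
  have h2 : 0 < 1 - x := by linarith
  rw [Real.exp_neg, inv_le_comm₀ (Real.exp_pos _) h2]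
  calc (1 - x)⁻¹ ≤ 2 * x + 1 := by
        rw [inv_le_iff_one_le_mul₀ h2]; nlinarith
    _ ≤ _ := Real.add_one_le_exp _

/-- One ultrafilter makes all bounded sequences converge at once, so the schemes have limits at
every `x` simultaneously without extracting subsequences. -/
theorem exists_tendsto_of_abs_le {ι : Type*} (l : Ultrafilter ι) {f : ι → ℝ} {M : ℝ}
    (hf : ∀ n, |f n| ≤ M) : ∃ y, Tendsto f l (𝓝 y) := by
  obtain ⟨y, -, hy⟩ := (isCompact_Icc (a := -M) (b := M)).ultrafilter_le_nhds (l.map f)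
    (by simp only [le_principal_iff]
        exact mem_map.2 (univ_mem' fun n => abs_le.1 (hf n)))
  exact ⟨y, hy⟩

/-- Solvability of the two-point problem for `u' = r z`, `z' = G(x, u, z)`. -/
theorem exists_system_solution {a b : ℝ} (hab : a < b) (A B : ℝ) {r : ℝ → ℝ}
    {G : ℝ → ℝ → ℝ → ℝ} {r₀ r₁ K C : ℝ} (hrc : Continuous r) (hr₀ : 0 < r₀) (hr : ∀ x, r₀ ≤ r x)
    (hr₁ : ∀ x, r x ≤ r₁) (hG : Continuous fun p : ℝ × ℝ × ℝ => G p.1 p.2.1 p.2.2)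
    (hK : 0 ≤ K) (hC : 0 ≤ C) (hgrowth : ∀ x y, |G x y 0| ≤ C * (1 + |y|))
    (hmono : ∀ x y y' z, 0 ≤ (G x y z - G x y' z) * (y - y'))
    (hlip : ∀ x y z z', |G x y z - G x y z'| ≤ K * |z - z'|) :
    ∃ u z : ℝ → ℝ, u a = A ∧ u b = B ∧ ∀ x ∈ Icc a b,
      HasDerivWithinAt u (r x * z x) (Icc a b) x ∧
      HasDerivWithinAt z (G x (u x) (z x)) (Icc a b) x := by
  have hba : 0 < b - a := sub_pos.2 hab
  have hrpos : ∀ x, 0 ≤ r x := fun x => hr₀.le.trans (hr x)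
  have hr₁0 : 0 ≤ r₁ := (hrpos 0).trans (hr₁ 0)
  -- The shift by `N` in the number of steps gives `h n * K ≤ 1 / 2` for every `n`, not only
  -- eventually.
  obtain ⟨N, hN⟩ := exists_nat_gt (2 * ((b - a) * K))
  set m : ℕ → ℕ := fun n => n + N + 1 with hm
  set h : ℕ → ℝ := fun n => (b - a) / m n with hhdef
  have hmpos : ∀ n, (0 : ℝ) < m n := fun n => by simp only [hm]; positivity
  have hpos : ∀ n, 0 < h n := fun n => div_pos hba (hmpos n)
  have hmh : ∀ n, m n * h n = b - a := fun n => by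
    simp only [hhdef]; field_simp [(hmpos n).ne']
  have h0 : Tendsto h atTop (𝓝 0) := by
    refine Tendsto.div_atTop tendsto_const_nhds ?_
    refine tendsto_natCast_atTop_atTop.comp ?_
    exact tendsto_atTop_mono (fun n => by simp only [hm, id]; omega) tendsto_id
  have hhK : ∀ n, h n * K ≤ 1 / 2 := by
    intro n
    simp only [hhdef]
    rw [div_mul_eq_mul_div, div_le_iff₀ (hmpos n)]
    have : (N : ℝ) ≤ m n := by simp only [hm]; push_cast; linarith [Nat.cast_nonneg (α := ℝ) n]
    linarith
  set E := Real.exp ((r₁ + C + K) * (b - a)) with hE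
  have hbound : ∀ n s k, k ≤ m n → |(euler r G a A (h n) s k).1| + |(euler r G a A (h n) s k).2| ≤
      E * (|A| + |s| + 1) := by
    intro n s k hk
    have e1 := euler_bound (a := a) (A := A) (s := s) hrpos hr₁ (hpos n).le hK hC hgrowth hlip k
    have hL : 0 ≤ h n * (r₁ + C + K) := mul_nonneg (hpos n).le (by positivity)
    have e2 : (1 + h n * (r₁ + C + K)) ^ k ≤ E := by
      calc _ ≤ (1 + h n * (r₁ + C + K)) ^ m n := pow_le_pow_right₀ (by linarith) hk
        _ ≤ (Real.exp (h n * (r₁ + C + K))) ^ m n := by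
          gcongr; rw [add_comm]; exact Real.add_one_le_exp _
        _ = E := by rw [← Real.exp_nat_mul, hE, ← hmh n]; congr 1; ring
    have e3 := mul_le_mul_of_nonneg_right e2 (show 0 ≤ |A| + |s| + 1 by positivity)
    linarith
  set c₀ := (b - a) * r₀ * Real.exp (-(2 * (K * (b - a)))) with hc₀
  have hc₀pos : 0 < c₀ := by positivity
  have hcomp : ∀ n s s', s ≤ s' → c₀ * (s' - s) ≤
      (euler r G a A (h n) s' (m n)).1 - (euler r G a A (h n) s (m n)).1 := by
    intro n s s' hs
    refine le_trans ?_ (euler_comparison (a := a) (A := A) hr₀.le hr (hpos n).le hK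
      ((hhK n).trans (by norm_num)) hmono hlip hs (m n)).1
    have e1 : Real.exp (-(2 * (K * (b - a)))) ≤ (1 - h n * K) ^ m n := by
      calc _ = (Real.exp (-(2 * (h n * K)))) ^ m n := by
            rw [← Real.exp_nat_mul, ← hmh n]; congr 1; ring
        _ ≤ _ := by
            gcongr
            exact exp_neg_two_mul_le (mul_nonneg (hpos n).le hK) (hhK n)
    rw [hmh, hc₀]
    have : 0 ≤ s' - s := by linarith
    gcongr
  -- At this radius the guaranteed change `c₀ * σ` of the terminal value outweighs `|B|` plus the
  -- bound for the shot with slope `0`, so the slopes `±σ` land on either side of `B`.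
  set σ := (|B| + E * (|A| + 1)) / c₀ with hσ
  have hσ0 : 0 ≤ σ := by positivity
  have hshoot : ∀ n, ∃ s, |s| ≤ σ ∧ (euler r G a A (h n) s (m n)).1 = B := by
    intro n
    have hz := hbound n 0 (m n) le_rfl
    rw [abs_zero, add_zero] at hz
    have hz1 : |(euler r G a A (h n) 0 (m n)).1| ≤ E * (|A| + 1) :=
      le_trans (le_add_of_nonneg_right (abs_nonneg _)) hz
    have hcσ : c₀ * σ = |B| + E * (|A| + 1) := by rw [hσ]; field_simp
    have e1 := hcomp n 0 σ hσ0
    have e2 := hcomp n (-σ) 0 (by linarith)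
    rw [sub_zero, hcσ] at e1
    rw [zero_sub, neg_neg, hcσ] at e2
    have hcont : Continuous fun s => (euler r G a A (h n) s (m n)).1 :=
      (continuous_euler hG (m n)).fst
    obtain ⟨s, hs, hsB⟩ := intermediate_value_Icc (show -σ ≤ σ by linarith) hcont.continuousOn
      (show B ∈ Icc _ _ from
        ⟨by linarith [neg_abs_le B, le_abs_self (euler r G a A (h n) 0 (m n)).1],
          by linarith [le_abs_self B, neg_abs_le (euler r G a A (h n) 0 (m n)).1]⟩)
    exact ⟨s, abs_le.2 hs, hsB⟩
  choose s hsσ hsB using hshoot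
  set M := E * (|A| + σ + 1) with hM
  have hUZ : ∀ n k, k ≤ m n → |(euler r G a A (h n) (s n) k).1| ≤ M ∧
      |(euler r G a A (h n) (s n) k).2| ≤ M := by
    intro n k hk
    have e1 := hbound n (s n) k hk
    have e2 : E * (|A| + |s n| + 1) ≤ M := by rw [hM]; gcongr; exact hsσ n
    exact ⟨by linarith [abs_nonneg (euler r G a A (h n) (s n) k).2],
      by linarith [abs_nonneg (euler r G a A (h n) (s n) k).1]⟩
  have hM0 : 0 ≤ M := by positivity
  have hidx : ∀ n, ∀ x ∈ Icc a b, ⌊(x - a) / h n⌋₊ ≤ m n := by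
    intro n x hx
    rw [← Nat.cast_le (α := ℝ)]
    have := (abs_floor_mul_sub_le (sub_nonneg.2 hx.1) (hpos n)).1
    refine le_of_mul_le_mul_right ?_ (hpos n)
    rw [hmh]
    linarith [hx.2]
  set l : Ultrafilter ℕ := hyperfilter ℕ with hl
  have hlat : (l : Filter ℕ) ≤ atTop := by
    rw [hl, ← Nat.cofinite_eq_atTop]; exact hyperfilter_le_cofinite
  have hu : ∀ x, ∃ y, x ∈ Icc a b →
      Tendsto (fun n => (euler r G a A (h n) (s n) ⌊(x - a) / h n⌋₊).1) l (𝓝 y) := by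
    intro x
    by_cases hx : x ∈ Icc a b
    · obtain ⟨y, hy⟩ := exists_tendsto_of_abs_le l fun n => (hUZ n _ (hidx n x hx)).1
      exact ⟨y, fun _ => hy⟩
    · exact ⟨0, fun h => absurd h hx⟩
  have hz : ∀ x, ∃ y, x ∈ Icc a b →
      Tendsto (fun n => (euler r G a A (h n) (s n) ⌊(x - a) / h n⌋₊).2) l (𝓝 y) := by
    intro x
    by_cases hx : x ∈ Icc a b
    · obtain ⟨y, hy⟩ := exists_tendsto_of_abs_le l fun n => (hUZ n _ (hidx n x hx)).2
      exact ⟨y, fun _ => hy⟩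
    · exact ⟨0, fun h => absurd h hx⟩
  choose u hu using hu
  choose z hz using hz
  -- A common bound for both slopes: all the schemes are Lipschitz with this constant.
  set M' := r₁ * M + (C * (1 + M) + K * M) with hM'
  have hM'0 : 0 ≤ M' := by positivity
  have hstep : ∀ n k, k ≤ m n →
      |r (a + k * h n) * (euler r G a A (h n) (s n) k).2 - 0| ≤ M' ∧
      |G (a + k * h n) (euler r G a A (h n) (s n) k).1 (euler r G a A (h n) (s n) k).2 - 0|
        ≤ M' := by
    intro n k hk
    obtain ⟨e1, e2⟩ := hUZ n k hk
    set U := (euler r G a A (h n) (s n) k).1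
    set Z := (euler r G a A (h n) (s n) k).2
    set x := a + k * h n
    rw [sub_zero, sub_zero]
    constructor
    · rw [abs_mul, abs_of_nonneg (hrpos x)]
      have := mul_le_mul (hr₁ x) e2 (abs_nonneg _) hr₁0
      have : 0 ≤ C * (1 + M) + K * M := by positivity
      linarith
    · have f1 := hlip x U Z 0
      rw [sub_zero] at f1
      have f2 := hgrowth x U
      have f3 := abs_sub_abs_le_abs_sub (G x U Z) (G x U 0)
      have f4 : C * (1 + |U|) ≤ C * (1 + M) := by gcongr
      have f5 : K * |Z| ≤ K * M := by gcongr
      have : 0 ≤ r₁ * M := by positivity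
      linarith
  -- Equi-Lipschitz schemes converging at `x` are close to the limit at all nodes near `x`;
  -- continuity of `r` and `G` then gives the slope convergence needed to differentiate the limit.
  have hmodulus : ∀ x ∈ Icc a b, ∀ η > 0, ∃ δ > 0, δ < η ∧ ∀ᶠ n in (l : Filter ℕ), ∀ k : ℕ,
      a + k * h n ≤ b → |a + k * h n - x| ≤ δ →
      |(euler r G a A (h n) (s n) k).1 - u x| < η ∧
      |(euler r G a A (h n) (s n) k).2 - z x| < η := by
    intro x hx η hη
    refine ⟨η / (4 * (M' + 1)), by positivity, ?_, ?_⟩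
    · rw [div_lt_iff₀ (by positivity)]; nlinarith
    set δ := η / (4 * (M' + 1)) with hδ
    have hδpos : 0 < δ := by positivity
    have hδM : M' * (2 * δ) < η / 2 := by
      have : δ * (4 * (M' + 1)) = η := by rw [hδ]; field_simp
      nlinarith
    have hun := (hu x hx).eventually (Metric.ball_mem_nhds _ (half_pos hη))
    have hzn := (hz x hx).eventually (Metric.ball_mem_nhds _ (half_pos hη))
    filter_upwards [hun, hzn, (h0.mono_left hlat).eventually (gt_mem_nhds hδpos)] with n hn1 hn2 hhn
    intro k hkb hkx
    rw [Real.dist_eq] at hn1 hn2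
    set i := ⌊(x - a) / h n⌋₊ with hi
    have hkm : k ≤ m n := by
      rw [← Nat.cast_le (α := ℝ)]
      refine le_of_mul_le_mul_right ?_ (hpos n)
      rw [hmh]; linarith
    have him := hidx n x hx
    have hfl := abs_floor_mul_sub_le (sub_nonneg.2 hx.1) (hpos n)
    rw [← hi] at hfl
    -- One `δ` for the distance from node `k` to `x`, one for rounding `x` down to node `i`.
    have hki : |((k : ℝ) - i) * h n| ≤ 2 * δ := by
      rw [abs_le] at hkx ⊢
      constructor <;> linarith
    have hosc : ∀ V φ : ℕ → ℝ, (∀ k, V (k + 1) = V k + h n * φ k) →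
        (∀ k, k ≤ m n → |φ k - 0| ≤ M') → |V k - V i| < η / 2 := by
      intro V φ hV hφ
      rcases le_total i k with hik | hik
      · have e := abs_scheme_sub_le (hpos n).le hV hik fun j _ hj => hφ j (hj.le.trans hkm)
        rw [mul_zero, sub_zero] at e
        calc _ ≤ _ := e
          _ ≤ M' * (2 * δ) := mul_le_mul_of_nonneg_left ((le_abs_self _).trans hki) hM'0
          _ < _ := hδM
      · have e := abs_scheme_sub_le (hpos n).le hV hik fun j _ hj => hφ j (hj.le.trans him)
        rw [mul_zero, sub_zero] at e
        rw [abs_sub_comm]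
        calc _ ≤ _ := e
          _ ≤ M' * (2 * δ) := by
            refine mul_le_mul_of_nonneg_left (le_trans (le_of_eq ?_) ((neg_le_abs _).trans hki)) hM'0
            ring
          _ < _ := hδM
    have k1 := hosc (fun k => (euler r G a A (h n) (s n) k).1) _ (fun k => rfl)
      fun k hk => (hstep n k hk).1
    have k2 := hosc (fun k => (euler r G a A (h n) (s n) k).2) _ (fun k => rfl)
      fun k hk => (hstep n k hk).2
    constructor
    · have := abs_sub_le (euler r G a A (h n) (s n) k).1 (euler r G a A (h n) (s n) i).1 (u x)
      linarith
    · have := abs_sub_le (euler r G a A (h n) (s n) k).2 (euler r G a A (h n) (s n) i).2 (z x)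
      linarith
  refine ⟨u, z, ?_, ?_, fun x hx => ⟨?_, ?_⟩⟩
  · refine tendsto_nhds_unique (hu a ⟨le_rfl, hab.le⟩) ?_
    simp [euler]
  · refine tendsto_nhds_unique (hu b ⟨hab.le, le_rfl⟩) ?_
    have : ∀ n, ⌊(b - a) / h n⌋₊ = m n := by
      intro n
      rw [← hmh n, mul_div_cancel_right₀ _ (hpos n).ne', Nat.floor_natCast]
    simp only [this, hsB]
    exact tendsto_const_nhds
  · refine hasDerivWithinAt_of_scheme hpos (h0.mono_left hlat)
      (V := fun n k => (euler r G a A (h n) (s n) k).1) (fun n k => rfl) hu hx fun ε hε => ?_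
    have hc : ContinuousAt (fun p : ℝ × ℝ => r p.1 * p.2) (x, z x) := by fun_prop
    obtain ⟨η, hη, hball⟩ := Metric.continuousAt_iff.1 hc ε hε
    obtain ⟨δ, hδ, hδη, hev⟩ := hmodulus x hx η hη
    refine ⟨δ, hδ, ?_⟩
    filter_upwards [hev] with n hn k hkb hkx
    refine (hball (x := (_, _)) ?_).le
    rw [Prod.dist_eq, max_lt_iff, Real.dist_eq, Real.dist_eq]
    exact ⟨hkx.trans_lt hδη, (hn k hkb hkx).2⟩
  · refine hasDerivWithinAt_of_scheme hpos (h0.mono_left hlat)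
      (V := fun n k => (euler r G a A (h n) (s n) k).2) (fun n k => rfl) hz hx fun ε hε => ?_
    obtain ⟨η, hη, hball⟩ := Metric.continuousAt_iff.1 (hG.continuousAt (x := (x, u x, z x))) ε hε
    obtain ⟨δ, hδ, hδη, hev⟩ := hmodulus x hx η hη
    refine ⟨δ, hδ, ?_⟩
    filter_upwards [hev] with n hn k hkb hkx
    refine (hball (x := (_, _, _)) ?_).le
    rw [Prod.dist_eq, max_lt_iff, Prod.dist_eq, max_lt_iff, Real.dist_eq, Real.dist_eq,
      Real.dist_eq]
    exact ⟨hkx.trans_lt hδη, hn k hkb hkx⟩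

/-! ### Regularization of functions of polynomial growth -/

theorem one_add_abs_le_mul (x c : ℝ) : 1 + |x| ≤ (1 + |x - c|) * (1 + |c|) := by
  have h1 : |x| ≤ |x - c| + |c| := by simpa using abs_add_le (x - c) c
  nlinarith [mul_nonneg (abs_nonneg (x - c)) (abs_nonneg c)]

theorem exists_schwartz_decay (ψ : 𝓢(ℝ, ℝ)) (m k : ℕ) :
    ∃ C, 0 ≤ C ∧ ∀ x, (1 + |x|) ^ m * ‖iteratedFDeriv ℝ k ψ x‖ ≤ C :=
  ⟨_, by positivity, fun x =>
    SchwartzMap.one_add_le_sup_seminorm_apply (𝕜 := ℝ) (m := (m, k)) le_rfl le_rfl ψ x⟩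

theorem exists_schwartz_decay_zero (ψ : 𝓢(ℝ, ℝ)) (m : ℕ) :
    ∃ C, 0 ≤ C ∧ ∀ x, |ψ x| ≤ C / (1 + |x|) ^ m := by
  obtain ⟨C, hC, h⟩ := exists_schwartz_decay ψ m 0
  refine ⟨C, hC, fun x => ?_⟩
  have := h x
  rw [norm_iteratedFDeriv_zero, Real.norm_eq_abs, mul_comm] at this
  rwa [le_div_iff₀ (by positivity)]

/-- Superposition of translates of a Schwartz function with rapidly decreasing weights. -/
theorem exists_schwartz_hasSum (φ : 𝓢(ℝ, ℝ)) (c : ℕ → ℝ) (hc : ∀ N : ℕ, (N : ℝ) ≤ |c N|) :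
    ∃ Ψ : 𝓢(ℝ, ℝ), ∀ x, HasSum (fun N => ((1 + |c N|) ^ N)⁻¹ * φ (x - c N)) (Ψ x) := by
  set w : ℕ → ℝ := fun N => ((1 + |c N|) ^ N)⁻¹ with hw
  set f : ℕ → 𝓢(ℝ, ℝ) := fun N => w N • SchwartzMap.compSubConstCLM ℝ (c N) φ with hf
  have hfx : ∀ N x, f N x = w N * φ (x - c N) := fun N x => by simp [hf]
  have hw0 : ∀ N, 0 ≤ w N := fun N => by simp only [hw]; positivity
  -- The exponent `N` in the weight eventually exceeds `m + 2`, and `N ≤ |c N|` turns the surplus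
  -- into a factor at most `1 / (N + 1) ^ 2`.
  have hsum : ∀ m : ℕ, Summable fun N => w N * (1 + |c N|) ^ m := by
    intro m
    have hs : Summable fun N : ℕ => 1 / ((N : ℝ) + 1) ^ 2 := by
      have := (summable_nat_add_iff 1).2 (Real.summable_one_div_nat_pow.2 (one_lt_two))
      simpa using this
    refine Summable.of_norm_bounded_eventually_nat hs ?_
    filter_upwards [eventually_ge_atTop (m + 2)] with N hN
    have h1 : (1 : ℝ) ≤ 1 + |c N| := by linarith [abs_nonneg (c N)]
    rw [Real.norm_of_nonneg (mul_nonneg (hw0 N) (by positivity))]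
    simp only [hw]
    obtain ⟨j, rfl⟩ := Nat.exists_eq_add_of_le hN
    set C := 1 + |c (m + 2 + j)|
    have h2 : ((m + 2 + j : ℕ) : ℝ) + 1 ≤ C := by
      have := hc (m + 2 + j); simp only [C]; linarith
    rw [inv_mul_eq_div, div_le_div_iff₀ (by positivity) (by positivity)]
    calc C ^ m * (((m + 2 + j : ℕ) : ℝ) + 1) ^ 2 ≤ C ^ m * C ^ 2 := by gcongr
      _ = C ^ (m + 2) := (pow_add _ _ _).symm
      _ ≤ C ^ (m + 2 + j) := pow_le_pow_right₀ h1 (by omega)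
      _ = _ := (one_mul _).symm
  have hbd : ∀ m k : ℕ, ∃ D, 0 ≤ D ∧ ∀ N x,
      ‖iteratedFDeriv ℝ k (f N) x‖ ≤ w N * (1 + |c N|) ^ m * D / (1 + |x|) ^ m := by
    intro m k
    obtain ⟨D, hD, h⟩ := exists_schwartz_decay φ m k
    refine ⟨D, hD, fun N x => ?_⟩
    have e : (f N : ℝ → ℝ) = w N • fun x => φ (x - c N) := by
      ext x; simp [hfx]
    have hcd : ContDiff ℝ k fun x => φ (x - c N) :=
      (φ.smooth k).comp (contDiff_id.sub contDiff_const)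
    rw [e, iteratedFDeriv_const_smul_apply hcd.contDiffAt, iteratedFDeriv_comp_sub, norm_smul,
      Real.norm_of_nonneg (hw0 N), le_div_iff₀ (by positivity)]
    calc w N * ‖iteratedFDeriv ℝ k φ (x - c N)‖ * (1 + |x|) ^ m
        ≤ w N * ‖iteratedFDeriv ℝ k φ (x - c N)‖ * ((1 + |x - c N|) * (1 + |c N|)) ^ m := by
          have := hw0 N
          gcongr
          exact one_add_abs_le_mul _ _
      _ = w N * (1 + |c N|) ^ m * ((1 + |x - c N|) ^ m * ‖iteratedFDeriv ℝ k φ (x - c N)‖) := by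
          rw [mul_pow]; ring
      _ ≤ _ := by
          have := hw0 N
          gcongr
          exact h _
  choose D hD hbd using hbd
  have hcd : ∀ N, ContDiff ℝ ((⊤ : ℕ∞) : WithTop ℕ∞) (f N) := fun N => (f N).smooth ⊤
  have hv : ∀ k : ℕ, (k : ℕ∞) ≤ ⊤ → Summable fun N => w N * (1 + |c N|) ^ 0 * D 0 k :=
    fun k _ => (hsum 0).mul_right _
  have hb : ∀ (k : ℕ) (N : ℕ) (x : ℝ), (k : ℕ∞) ≤ ⊤ →
      ‖iteratedFDeriv ℝ k (f N) x‖ ≤ w N * (1 + |c N|) ^ 0 * D 0 k := fun k N x _ => by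
    simpa using hbd 0 k N x
  refine ⟨⟨fun x => ∑' N, f N x, contDiff_tsum hcd hv hb, fun m k => ?_⟩, fun x => ?_⟩
  · refine ⟨∑' N, w N * (1 + |c N|) ^ m * D m k, fun x => ?_⟩
    rw [iteratedFDeriv_tsum_apply hcd hv hb le_top]
    have h1 : ‖∑' N, iteratedFDeriv ℝ k (f N) x‖ ≤
        (∑' N, w N * (1 + |c N|) ^ m * D m k) / (1 + |x|) ^ m :=
      tsum_of_norm_bounded (((hsum m).mul_right _).hasSum.div_const _) fun N => hbd m k N x
    rw [le_div_iff₀ (by positivity)] at h1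
    rw [Real.norm_eq_abs x]
    refine le_trans ?_ h1
    rw [mul_comm]
    gcongr
    linarith
  · have : Summable fun N => f N x := by
      refine Summable.of_norm_bounded (hv 0 le_top) fun N => ?_
      simpa using hb 0 N x le_top
    have h2 := this.hasSum
    simp only [hfx] at h2
    exact h2

/-- The unit bump as a Schwartz function. -/
theorem exists_schwartz_bump : ∃ φ : 𝓢(ℝ, ℝ), (∀ x, 0 ≤ φ x) ∧ ∀ x, |x| ≤ 1 → φ x = 1 := by
  let φ : ContDiffBump (0 : ℝ) := ⟨1, 2, one_pos, one_lt_two⟩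
  refine ⟨φ.hasCompactSupport.toSchwartzMap φ.contDiff, fun x => φ.nonneg, fun x hx => ?_⟩
  exact φ.one_of_mem_closedBall (by simpa [φ] using hx)

theorem exists_isMollifier : ∃ Φ : 𝓢(ℝ, ℝ), IsMollifier Φ := by
  let φ : ContDiffBump (0 : ℝ) := ⟨1, 2, one_pos, one_lt_two⟩
  exact ⟨(φ.hasCompactSupport_normed (μ := volume)).toSchwartzMap φ.contDiff_normed,
    φ.integral_normed⟩

/-- Adding a multiple of a fixed mollifier to the reflected test function makes its integral one.
The convolution hypothesis at the point `0` applies to the sum and to the fixed mollifier, and one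
subtracts. -/
theorem integrable_mul_schwartz {f : ℝ → ℝ}
    (hf : ∀ Φ : 𝓢(ℝ, ℝ), IsMollifier Φ →
      ConvolutionExists f (scaled Φ 1) (ContinuousLinearMap.lsmul ℝ ℝ) volume)
    (Ψ : 𝓢(ℝ, ℝ)) : Integrable fun t => f t * Ψ t := by
  have h1 : ∀ Φ : 𝓢(ℝ, ℝ), IsMollifier Φ → Integrable fun t => f t * Φ (-t) := by
    intro Φ hΦ
    simpa [ConvolutionExistsAt, scaled] using hf Φ hΦ 0
  obtain ⟨Φ₀, hΦ₀⟩ := exists_isMollifier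
  set Ψ' := SchwartzMap.compCLMOfContinuousLinearEquiv ℝ (ContinuousLinearEquiv.neg ℝ) Ψ with hΨ'
  have hΨ'x : ∀ x, Ψ' x = Ψ (-x) := fun x => by simp [hΨ']
  set d : ℝ := 1 - ∫ x, Ψ' x with hd
  have hmol : IsMollifier (Ψ' + d • Φ₀) := by
    have : ∫ x, (Ψ' + d • Φ₀) x = (∫ x, Ψ' x) + d * ∫ x, Φ₀ x := by
      simp only [add_apply, smul_apply, smul_eq_mul]
      rw [integral_add Ψ'.integrable (Φ₀.integrable.const_mul d), integral_const_mul]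
    rw [IsMollifier, this, hΦ₀, hd]; ring
  refine ((h1 _ hmol).sub ((h1 _ hΦ₀).const_mul d)).congr (ae_of_all _ fun t => ?_)
  simp [hΨ'x]
  ring

/-- Gliding hump. Otherwise there are centres `c N` whose unit windows carry mass at least `(1 + |c
N|) ^ N`. Bumps at these centres with the inverse weights add up to a Schwartz function, yet each
bump contributes at least `1` to the integral against `|f|`. -/
theorem exists_local_growth {f : ℝ → ℝ} (hfc : Continuous f)
    (hf : ∀ Ψ : 𝓢(ℝ, ℝ), Integrable fun t => f t * Ψ t) :
    ∃ (N : ℕ) (C : ℝ), ∀ c, ∫ t in (c - 1)..(c + 1), |f t| ≤ C * (1 + |c|) ^ N := by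
  by_contra! hcon
  have hpick : ∀ N : ℕ, ∃ c, (N : ℝ) ≤ |c| ∧ (1 + |c|) ^ N ≤ ∫ t in (c - 1)..(c + 1), |f t| := by
    intro N
    set B := ∫ t in (-(N + 1 : ℝ))..(N + 1), |f t| with hB
    have hB0 : 0 ≤ B := intervalIntegral.integral_nonneg (by linarith [N.cast_nonneg (α := ℝ)])
      fun _ _ => abs_nonneg _
    -- `B` is the mass of `[-(N+1), N+1]`, which contains every window centred in `|c| < N`; a
    -- window of mass above `B` thus forces `N ≤ |c|`.
    obtain ⟨c, hc⟩ := hcon N (B + 1)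
    have h1 : (1 : ℝ) ≤ (1 + |c|) ^ N := one_le_pow₀ (by linarith [abs_nonneg c])
    refine ⟨c, ?_, by nlinarith⟩
    by_contra! hlt
    have h2 : ∫ t in (c - 1)..(c + 1), |f t| ≤ B := by
      rw [abs_lt] at hlt
      refine intervalIntegral.integral_mono_interval (by linarith) (by linarith) (by linarith)
        (ae_of_all _ fun _ => abs_nonneg _) (hfc.abs.intervalIntegrable _ _)
    nlinarith
  choose c hc hcm using hpick
  obtain ⟨φ, hφ0, hφ1⟩ := exists_schwartz_bump
  obtain ⟨Ψ, hΨ⟩ := exists_schwartz_hasSum φ c hc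
  have hint : ∀ N, Integrable fun t => |f t| * φ (t - c N) := by
    intro N
    refine (hf (SchwartzMap.compSubConstCLM ℝ (c N) φ)).abs.congr (ae_of_all _ fun t => ?_)
    simp [abs_mul, abs_of_nonneg (hφ0 _)]
  have hterm0 : ∀ N x, 0 ≤ ((1 + |c N|) ^ N)⁻¹ * φ (x - c N) := fun N x =>
    mul_nonneg (by positivity) (hφ0 _)
  have hlow : ∀ N, (1 + |c N|) ^ N ≤ ∫ t, |f t| * φ (t - c N) := by
    intro N
    refine (hcm N).trans ?_
    rw [intervalIntegral.integral_of_le (by linarith)]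
    calc ∫ t in Ioc (c N - 1) (c N + 1), |f t|
        = ∫ t in Ioc (c N - 1) (c N + 1), |f t| * φ (t - c N) := by
          refine setIntegral_congr_fun measurableSet_Ioc fun t ht => ?_
          rw [hφ1 _ (abs_le.2 ⟨by linarith [ht.1], by linarith [ht.2]⟩), mul_one]
      _ ≤ _ := setIntegral_le_integral (hint N)
          (ae_of_all _ fun t => mul_nonneg (abs_nonneg _) (hφ0 _))
  obtain ⟨M, hM⟩ := exists_nat_gt (∫ t, |f t * Ψ t|)
  have hfin : (M : ℝ) ≤ ∫ t, |f t * Ψ t| := by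
    calc (M : ℝ) = ∑ N ∈ Finset.range M, (1 : ℝ) := by simp
      _ ≤ ∑ N ∈ Finset.range M, ((1 + |c N|) ^ N)⁻¹ * ∫ t, |f t| * φ (t - c N) := by
        refine Finset.sum_le_sum fun N _ => ?_
        calc (1 : ℝ) = ((1 + |c N|) ^ N)⁻¹ * (1 + |c N|) ^ N :=
              (inv_mul_cancel₀ (by positivity)).symm
          _ ≤ _ := mul_le_mul_of_nonneg_left (hlow N) (by positivity)
      _ = ∫ t, ∑ N ∈ Finset.range M, ((1 + |c N|) ^ N)⁻¹ * (|f t| * φ (t - c N)) := by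
        rw [integral_finsetSum _ fun N _ => (hint N).const_mul _]
        simp only [integral_const_mul]
      _ ≤ _ := by
        refine integral_mono (integrable_finsetSum _ fun N _ => (hint N).const_mul _)
          (hf Ψ).abs fun t => ?_
        have h1 : ∑ N ∈ Finset.range M, ((1 + |c N|) ^ N)⁻¹ * φ (t - c N) ≤ Ψ t :=
          sum_le_hasSum _ (fun N _ => hterm0 N t) (hΨ t)
        simp only [abs_mul]
        calc _ = |f t| * ∑ N ∈ Finset.range M, ((1 + |c N|) ^ N)⁻¹ * φ (t - c N) := by
              rw [Finset.mul_sum]; exact Finset.sum_congr rfl fun _ _ => by ring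
          _ ≤ |f t| * |Ψ t| := by gcongr; exact h1.trans (le_abs_self _)
  linarith

/-- Summing over unit intervals, two powers beyond the local growth exponent give a convergent
series. The factor `2 ^ (N + 2)` comes from `1 + |n| ≤ 2 * (1 + |t|)` on `(n, n + 1]`. -/
theorem exists_integrable_div_pow {f : ℝ → ℝ} (hfc : Continuous f)
    (hf : ∀ Ψ : 𝓢(ℝ, ℝ), Integrable fun t => f t * Ψ t) :
    ∃ N : ℕ, 2 ≤ N ∧ Integrable fun t => f t / (1 + |t|) ^ N := by
  obtain ⟨N, C, hC⟩ := exists_local_growth hfc hf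
  refine ⟨N + 2, by omega, ?_⟩
  have hcont : Continuous fun t => f t / (1 + |t|) ^ (N + 2) :=
    hfc.div (by fun_prop) fun t => by positivity
  rw [← integrableOn_univ, ← iUnion_Ioc_intCast ℝ]
  refine integrableOn_iUnion_of_summable_integral_norm
    (fun n => (hcont.integrableOn_Icc).mono_set Ioc_subset_Icc_self) ?_
  have hs : Summable fun n : ℤ => (C * 2 ^ (N + 2)) * (1 / (1 + |(n : ℝ)|) ^ 2) := by
    have h1 : Summable fun N : ℕ => 1 / (1 + (N : ℝ)) ^ 2 := by
      have := (summable_nat_add_iff 1).2 (Real.summable_one_div_nat_pow.2 (one_lt_two))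
      simpa [add_comm] using this
    refine Summable.mul_left _ (Summable.of_nat_of_neg ?_ ?_)
    · simpa using h1
    · simpa using h1
  refine Summable.of_nonneg_of_le (fun n => integral_nonneg fun _ => norm_nonneg _)
    (fun n => ?_) hs
  set q := 1 + |(n : ℝ)| with hq
  have hq0 : 0 < q := by positivity
  calc ∫ t in Ioc (n : ℝ) (n + 1), ‖f t / (1 + |t|) ^ (N + 2)‖
      ≤ ∫ t in Ioc (n : ℝ) (n + 1), |f t| * (2 ^ (N + 2) / q ^ (N + 2)) := by
        refine setIntegral_mono_on (hcont.norm.integrableOn_Icc.mono_set Ioc_subset_Icc_self)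
          ((by fun_prop : Continuous fun t => |f t| * (2 ^ (N + 2) / q ^ (N + 2))
            ).integrableOn_Icc.mono_set Ioc_subset_Icc_self) measurableSet_Ioc fun t ht => ?_
        rw [Real.norm_eq_abs, abs_div, abs_of_nonneg (show 0 ≤ (1 + |t|) ^ (N + 2) by positivity),
          div_eq_mul_one_div |f t|]
        refine mul_le_mul_of_nonneg_left ?_ (abs_nonneg _)
        rw [div_le_div_iff₀ (by positivity) (by positivity), one_mul, ← mul_pow]
        gcongr
        have h1 : |(n : ℝ)| - |t| ≤ |n - t| := abs_sub_abs_le_abs_sub _ _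
        have h2 : |(n : ℝ) - t| ≤ 1 := abs_le.2 ⟨by linarith [ht.2], by linarith [ht.1]⟩
        linarith [abs_nonneg t]
    _ = (∫ t in (n : ℝ)..(n + 1), |f t|) * (2 ^ (N + 2) / q ^ (N + 2)) := by
        rw [integral_mul_const, intervalIntegral.integral_of_le (by linarith)]
    _ ≤ (C * q ^ N) * (2 ^ (N + 2) / q ^ (N + 2)) := by
        gcongr
        refine le_trans ?_ (hC n)
        exact intervalIntegral.integral_mono_interval (by linarith) (by linarith) le_rfl
          (ae_of_all _ fun _ => abs_nonneg _) (hfc.abs.intervalIntegrable _ _)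
    _ = _ := by
        rw [pow_add q]; field_simp

/-! ### Smoothness and convergence of the mollified coefficients -/

section Kernel

variable {f : ℝ → ℝ} {N : ℕ}

theorem exists_kernel_bound (ψ : 𝓢(ℝ, ℝ)) (N : ℕ) : ∃ C, 0 ≤ C ∧ ∀ ν : ℝ, 1 ≤ ν → ∀ x t,
    |ψ (ν * (x - t))| ≤ C * (1 + |x|) ^ N * (1 / (1 + |t|) ^ N) := by
  obtain ⟨C, hC, h⟩ := exists_schwartz_decay_zero ψ N
  refine ⟨C, hC, fun ν hν x t => (h _).trans ?_⟩
  rw [mul_one_div, div_le_div_iff₀ (by positivity) (by positivity), mul_assoc, ← mul_pow]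
  gcongr
  have h1 := one_add_abs_le_mul t x
  have h2 : |t - x| ≤ |ν * (x - t)| := by
    rw [abs_mul, abs_sub_comm, abs_of_nonneg (by linarith : 0 ≤ ν)]
    exact le_mul_of_one_le_left (abs_nonneg _) hν
  calc 1 + |t| ≤ (1 + |t - x|) * (1 + |x|) := h1
    _ ≤ (1 + |ν * (x - t)|) * (1 + |x|) := by gcongr
    _ = _ := mul_comm _ _

theorem hasDerivAt_integral_kernel (hfc : Continuous f)
    (hf : Integrable fun t => f t / (1 + |t|) ^ N) (ψ : 𝓢(ℝ, ℝ)) {ν : ℝ} (hν : 1 ≤ ν) (x : ℝ) :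
    Integrable (fun t => f t * ψ (ν * (x - t))) ∧
    HasDerivAt (fun x => ∫ t, f t * ψ (ν * (x - t)))
      (∫ t, f t * (ν * SchwartzMap.derivCLM ℝ ℝ ψ (ν * (x - t)))) x := by
  have hint : ∀ x, Integrable fun t => f t * ψ (ν * (x - t)) := by
    intro x
    obtain ⟨C, hC, h⟩ := exists_kernel_bound ψ N
    refine (hf.abs.const_mul (C * (1 + |x|) ^ N)).mono'
      (by have := ψ.continuous; fun_prop) (ae_of_all _ fun t => ?_)
    rw [Real.norm_eq_abs, abs_mul, abs_div, abs_of_nonneg (show 0 ≤ (1 + |t|) ^ N by positivity)]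
    calc _ ≤ |f t| * (C * (1 + |x|) ^ N * (1 / (1 + |t|) ^ N)) := by gcongr; exact h ν hν x t
      _ = _ := by ring
  refine ⟨hint x, ?_⟩
  set ψ' := SchwartzMap.derivCLM ℝ ℝ ψ with hψ'
  obtain ⟨C, hC, h⟩ := exists_kernel_bound ψ' N
  have hψc := ψ.continuous
  have hψ'c := ψ'.continuous
  refine (hasDerivAt_integral_of_dominated_loc_of_deriv_le (Metric.ball_mem_nhds x one_pos)
    (F := fun x t => f t * ψ (ν * (x - t)))
    (F' := fun x t => f t * (ν * ψ' (ν * (x - t))))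
    (bound := fun t => ν * (C * (2 + |x|) ^ N) * |f t / (1 + |t|) ^ N|)
    (Eventually.of_forall fun y => by fun_prop) (hint x) (by fun_prop)
    (ae_of_all _ fun t y hy => ?_) (hf.abs.const_mul _) (ae_of_all _ fun t y hy => ?_)).2
  · rw [Real.norm_eq_abs, abs_mul, abs_mul, abs_div,
      abs_of_nonneg (show 0 ≤ (1 + |t|) ^ N by positivity), abs_of_nonneg (by linarith : 0 ≤ ν)]
    have hy1 : |y| ≤ 1 + |x| := by
      rw [Metric.mem_ball, Real.dist_eq] at hy
      linarith [abs_sub_abs_le_abs_sub y x]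
    have h1 : |ψ' (ν * (y - t))| ≤ C * (2 + |x|) ^ N * (1 / (1 + |t|) ^ N) := by
      refine (h ν hν y t).trans ?_
      gcongr ?_ * ?_ ^ N * _
      linarith
    calc _ ≤ |f t| * (ν * (C * (2 + |x|) ^ N * (1 / (1 + |t|) ^ N))) := by gcongr
      _ = _ := by ring
  · have h1 : HasDerivAt ψ (ψ' (ν * (y - t))) (ν * (y - t)) := by
      rw [hψ', SchwartzMap.derivCLM_apply]
      exact ψ.differentiableAt.hasDerivAt
    have h2 : HasDerivAt (fun y => ν * (y - t)) ν y := by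
      simpa using ((hasDerivAt_id y).sub_const t).const_mul ν
    have := (h1.comp y h2).const_mul (f t)
    rwa [mul_comm (ψ' _) ν] at this

theorem mollify_eq (f : ℝ → ℝ) (Φ : 𝓢(ℝ, ℝ)) (n : ℕ) :
    mollify f Φ n = fun x => n * ∫ t, f t * Φ (n * (x - t)) := by
  ext x
  simp only [mollify, convolution, scaled, ContinuousLinearMap.lsmul_apply, smul_eq_mul]
  rw [← integral_const_mul]
  congr 1; ext t; ring

theorem continuous_mollify (hfc : Continuous f) (hf : Integrable fun t => f t / (1 + |t|) ^ N)
    (Φ : 𝓢(ℝ, ℝ)) {n : ℕ} (hn : 1 ≤ n) : Continuous (mollify f Φ n) := by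
  rw [mollify_eq]
  refine continuous_const.mul (continuous_iff_continuousAt.2 fun x => ?_)
  exact (hasDerivAt_integral_kernel hfc hf Φ (by exact_mod_cast hn) x).2.continuousAt

theorem continuous_deriv_mollify (hfc : Continuous f)
    (hf : Integrable fun t => f t / (1 + |t|) ^ N) (Φ : 𝓢(ℝ, ℝ)) {n : ℕ} (hn : 1 ≤ n) :
    Continuous (deriv (mollify f Φ n)) := by
  have hn' : (1 : ℝ) ≤ n := by exact_mod_cast hn
  have h1 : deriv (mollify f Φ n) =
      fun x => n * (n * ∫ t, f t * SchwartzMap.derivCLM ℝ ℝ Φ (n * (x - t))) := by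
    ext x
    rw [mollify_eq, ((hasDerivAt_integral_kernel hfc hf Φ hn' x).2.const_mul (n : ℝ)).deriv]
    congr 1
    rw [← integral_const_mul]
    exact integral_congr_ae (ae_of_all _ fun t => by ring)
  rw [h1]
  refine continuous_const.mul (continuous_const.mul (continuous_iff_continuousAt.2 fun x => ?_))
  exact (hasDerivAt_integral_kernel hfc hf _ hn' x).2.continuousAt

theorem integral_kernel_eq (g : ℝ → ℝ) (Φ : ℝ → ℝ) {n : ℝ} (hn : 0 < n) (x : ℝ) :
    n * ∫ t, g t * Φ (n * (x - t)) = ∫ s, g (x - s / n) * Φ s := by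
  have h1 := integral_sub_left_eq_self (fun t => g (x - t) * Φ (n * t)) volume x
  have h2 := Measure.integral_comp_mul_left (fun s => g (x - s / n) * Φ s) n
  simp only [sub_sub_cancel] at h1
  simp only [mul_div_cancel_left₀ _ hn.ne'] at h2
  rw [h1, h2, abs_of_pos (inv_pos.2 hn), smul_eq_mul, mul_inv_cancel_left₀ hn.ne']

/-- Split off `g`, the bounded function obtained by freezing `f` outside `[x₀ - 2, x₀ + 2]`. For
`g`, rescaling and dominated convergence apply; `f - g` vanishes near `x₀`, so the kernel's decay
makes its contribution `O(1/n)`. -/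
theorem tendsto_mollify (hfc : Continuous f) (hN : 2 ≤ N)
    (hf : Integrable fun t => f t / (1 + |t|) ^ N) {Φ : 𝓢(ℝ, ℝ)} (hΦ : IsMollifier Φ) (x₀ : ℝ) :
    Tendsto (fun q : ℕ × ℝ => mollify f Φ q.1 q.2) (atTop ×ˢ 𝓝 x₀) (𝓝 (f x₀)) := by
  have hle : x₀ - 2 ≤ x₀ + 2 := by linarith
  set g : ℝ → ℝ := fun t => f (projIcc (x₀ - 2) (x₀ + 2) hle t) with hg
  have hgc : Continuous g := hfc.comp (continuous_subtype_val.comp continuous_projIcc)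
  have hgeq : ∀ t, |t - x₀| ≤ 2 → g t = f t := by
    intro t ht
    rw [abs_le] at ht
    simp only [hg]
    rw [projIcc_of_mem hle ⟨by linarith [ht.1], by linarith [ht.2]⟩]
  obtain ⟨M, hM⟩ : ∃ M, ∀ t, |g t| ≤ M := by
    obtain ⟨M, hM⟩ := (isCompact_Icc (a := x₀ - 2) (b := x₀ + 2)).exists_bound_of_continuousOn
      hfc.continuousOn
    exact ⟨M, fun t => hM _ (projIcc (x₀ - 2) (x₀ + 2) hle t).2⟩
  have hgi : Integrable fun t => g t / (1 + |t|) ^ N := by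
    have h1 : Integrable fun t : ℝ => M * (1 + ‖t‖) ^ (-(N : ℝ)) := by
      refine (integrable_one_add_norm ?_).const_mul M
      simp only [Module.finrank_self]
      exact_mod_cast hN
    refine h1.mono' (hgc.div (by fun_prop) fun t => by positivity).aestronglyMeasurable
      (ae_of_all _ fun t => ?_)
    rw [Real.rpow_neg (by positivity), Real.rpow_natCast, Real.norm_eq_abs, abs_div,
      abs_of_nonneg (show 0 ≤ (1 + |t|) ^ N by positivity), ← div_eq_mul_inv, Real.norm_eq_abs]
    gcongr
    exact hM t
  have hdi : Integrable fun t => (f t - g t) / (1 + |t|) ^ N := by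
    simp only [sub_div]; exact hf.sub hgi
  have hmain : Tendsto (fun q : ℕ × ℝ => ∫ s, g (q.2 - s / q.1) * Φ s) (atTop ×ˢ 𝓝 x₀)
      (𝓝 (f x₀)) := by
    have hlim : f x₀ = ∫ s, g x₀ * Φ s := by
      rw [integral_const_mul, hΦ, mul_one, hgeq x₀ (by simp)]
    rw [hlim]
    have hΦc := Φ.continuous
    refine tendsto_integral_filter_of_dominated_convergence (fun s => M * |Φ s|)
      (Eventually.of_forall fun q => by fun_prop)
      (Eventually.of_forall fun q => ae_of_all _ fun s => ?_)
      (Φ.integrable.abs.const_mul M) (ae_of_all _ fun s => ?_)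
    · rw [Real.norm_eq_abs, abs_mul]
      gcongr
      exact hM _
    · refine Tendsto.mul_const _ ((hgc.tendsto x₀).comp ?_)
      have h1 : Tendsto (fun q : ℕ × ℝ => s / (q.1 : ℝ)) (atTop ×ˢ 𝓝 x₀) (𝓝 0) :=
        (tendsto_const_nhds.div_atTop tendsto_natCast_atTop_atTop).comp tendsto_fst
      simpa using tendsto_snd.sub h1
  -- Of the two extra powers, one cancels the prefactor `n` of the kernel and the other yields `1 /
  -- n`.
  obtain ⟨C, hC, hdec⟩ := exists_schwartz_decay_zero Φ (N + 2)
  set I := ∫ t, |(f t - g t) / (1 + |t|) ^ N|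
  have herr : ∀ᶠ q : ℕ × ℝ in atTop ×ˢ 𝓝 x₀,
      |mollify f Φ q.1 q.2 - ∫ s, g (q.2 - s / q.1) * Φ s| ≤
        C * (2 + |x₀|) ^ N * I / q.1 := by
    have hball : ∀ᶠ x in 𝓝 x₀, |x - x₀| < 1 := by
      filter_upwards [Metric.ball_mem_nhds x₀ one_pos] with x hx
      rwa [Metric.mem_ball, Real.dist_eq] at hx
    filter_upwards [(eventually_ge_atTop 1).prod_mk hball] with ⟨n, x⟩ ⟨hn, hx⟩
    simp only at hn hx ⊢
    have hn' : (1 : ℝ) ≤ n := by exact_mod_cast hn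
    have hn0 : (0 : ℝ) < n := by linarith
    have h1 := (hasDerivAt_integral_kernel hfc hf Φ hn' x).1
    have h2 := (hasDerivAt_integral_kernel hgc hgi Φ hn' x).1
    rw [mollify_eq, ← integral_kernel_eq g Φ hn0 x, ← mul_sub, ← integral_sub h1 h2,
      ← integral_const_mul, ← Real.norm_eq_abs]
    refine (norm_integral_le_integral_norm _).trans ?_
    rw [mul_div_right_comm, ← integral_const_mul]
    refine integral_mono_of_nonneg (ae_of_all _ fun t => norm_nonneg _)
      (hdi.abs.const_mul _) (ae_of_all _ fun t => ?_)
    simp only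
    rw [← sub_mul, Real.norm_eq_abs]
    by_cases ht : |t - x₀| ≤ 2
    · simp [hgeq t ht]
    push Not at ht
    have hxt : 1 ≤ |x - t| := by
      have := abs_sub_le t x x₀
      rw [abs_sub_comm t x] at this
      linarith
    have hx1 : 1 + |x| ≤ 2 + |x₀| := by linarith [abs_sub_abs_le_abs_sub x x₀]
    have hker : n * |Φ (n * (x - t))| ≤ C * (2 + |x₀|) ^ N / n * (1 / (1 + |t|) ^ N) := by
      have e1 := hdec (n * (x - t))
      rw [abs_mul, abs_of_pos hn0] at e1
      have e2 : (1 + |t|) * n ^ 0 ≤ (1 + n * |x - t|) * (2 + |x₀|) := by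
        calc (1 + |t|) * n ^ 0 = 1 + |t| := by simp
          _ ≤ (1 + |t - x|) * (1 + |x|) := one_add_abs_le_mul t x
          _ ≤ _ := by
            rw [abs_sub_comm t x]
            gcongr
            exact le_mul_of_one_le_left (abs_nonneg _) hn'
      rw [pow_zero, mul_one] at e2
      have e3 : (n : ℝ) ≤ 1 + n * |x - t| := by nlinarith
      calc n * |Φ (n * (x - t))| ≤ n * (C / (1 + n * |x - t|) ^ (N + 2)) := by gcongr
        _ ≤ C * (2 + |x₀|) ^ N / n * (1 / (1 + |t|) ^ N) := by
          rw [div_mul_div_comm, mul_one, mul_div_assoc', div_le_div_iff₀ (by positivity)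
            (by positivity)]
          calc n * C * (n * (1 + |t|) ^ N) = C * (n ^ 2 * (1 + |t|) ^ N) := by ring
            _ ≤ C * ((1 + n * |x - t|) ^ 2 * ((1 + n * |x - t|) * (2 + |x₀|)) ^ N) := by gcongr
            _ = _ := by rw [mul_pow, pow_add]; ring
    calc |n * ((f t - g t) * Φ (n * (x - t)))|
        = |f t - g t| * (n * |Φ (n * (x - t))|) := by
          rw [abs_mul, abs_mul, abs_of_pos hn0]; ring
      _ ≤ |f t - g t| * (C * (2 + |x₀|) ^ N / n * (1 / (1 + |t|) ^ N)) := by gcongr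
      _ = _ := by
          rw [abs_div, abs_of_nonneg (show 0 ≤ (1 + |t|) ^ N by positivity)]; ring
  have herr0 : Tendsto (fun q : ℕ × ℝ => C * (2 + |x₀|) ^ N * I / (q.1 : ℝ)) (atTop ×ˢ 𝓝 x₀)
      (𝓝 0) :=
    (tendsto_const_nhds.div_atTop tendsto_natCast_atTop_atTop).comp tendsto_fst
  have hdiff := squeeze_zero_norm' (f := fun q : ℕ × ℝ =>
    mollify f Φ q.1 q.2 - ∫ s, g (q.2 - s / q.1) * Φ s) herr herr0
  simpa using hdiff.add hmain

end Kernel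

/-! ### Continuous convergence -/

/-- Continuous convergence `F_n → f`: `F_n(x_n) → f(x)` whenever `x_n → x`. -/
def ConvergesContinuously (F : ℕ → ℝ → ℝ) (f : ℝ → ℝ) : Prop :=
  ∀ x, Tendsto (fun q : ℕ × ℝ => F q.1 q.2) (atTop ×ˢ 𝓝 x) (𝓝 (f x))

/-- As a joint limit, locally uniform convergence inherits products, quotients and compositions from
the calculus of `Tendsto`. -/
theorem tendstoLocallyUniformly_iff_convergesContinuously {F : ℕ → ℝ → ℝ} {f : ℝ → ℝ}
    (hf : Continuous f) : TendstoLocallyUniformly F f atTop ↔ ConvergesContinuously F f := by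
  rw [tendstoLocallyUniformly_iff_forall_tendsto]
  refine forall_congr' fun x => ?_
  have h1 : Tendsto (fun q : ℕ × ℝ => f q.2) (atTop ×ˢ 𝓝 x) (𝓝 (f x)) :=
    (hf.tendsto x).comp tendsto_snd
  rw [tendsto_uniformity_iff_dist_tendsto_zero]
  refine ⟨fun h => (tendsto_iff_of_dist h).1 h1, fun h => ?_⟩
  simpa using h1.dist h

theorem IsCompact.eventually_forall_of_prod {K : Set ℝ} (hK : IsCompact K) {P : ℕ → ℝ → Prop}
    (h : ∀ x, ∀ᶠ q : ℕ × ℝ in atTop ×ˢ 𝓝 x, P q.1 q.2) : ∀ᶠ n in atTop, ∀ x ∈ K, P n x := by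
  have h1 : {q : ℕ × ℝ | P q.1 q.2} ∈ (atTop : Filter ℕ) ×ˢ 𝓝ˢ K :=
    hK.mem_prod_nhdsSet_of_forall fun x _ => h x
  obtain ⟨t₁, ht₁, t₂, ht₂, hsub⟩ := mem_prod_iff.1 h1
  filter_upwards [ht₁] with n hn x hx
  exact hsub (mk_mem_prod hn (subset_of_mem_nhdsSet ht₂ hx))

/-- To prove a local property of sequences it is enough to prove it eventually on bounded sets. -/
theorem eventually_prod_of_forall_abs_le {P : ℕ → ℝ → Prop}
    (h : ∀ R, ∀ᶠ n in atTop, ∀ x, |x| ≤ R → P n x) (x : ℝ) :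
    ∀ᶠ q : ℕ × ℝ in atTop ×ˢ 𝓝 x, P q.1 q.2 := by
  have hball : ∀ᶠ y in 𝓝 x, |y| ≤ |x| + 1 := by
    filter_upwards [Metric.ball_mem_nhds x one_pos] with y hy
    rw [Metric.mem_ball, Real.dist_eq] at hy
    linarith [abs_sub_abs_le_abs_sub y x]
  filter_upwards [(h (|x| + 1)).prod_mk hball] with q hq
  exact hq.1 _ hq.2

theorem ConvergesContinuously.tendsto {F : ℕ → ℝ → ℝ} {f : ℝ → ℝ} (h : ConvergesContinuously F f)
    (x : ℝ) : Tendsto (fun n => F n x) atTop (𝓝 (f x)) :=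
  (h x).comp (tendsto_id.prodMk (tendsto_const_nhds (x := x)))

theorem ConvergesContinuously.integral {F : ℕ → ℝ → ℝ} {f : ℝ → ℝ}
    (h : ConvergesContinuously F f) (hF : ∀ᶠ n in atTop, Continuous (F n)) (hf : Continuous f) :
    ConvergesContinuously (fun n x => ∫ t in (0 : ℝ)..x, F n t) fun x => ∫ t in (0 : ℝ)..x, f t := by
  have hprim : Continuous fun x => ∫ t in (0 : ℝ)..x, f t :=
    intervalIntegral.continuous_primitive (fun a b => hf.intervalIntegrable a b) 0
  rw [← tendstoLocallyUniformly_iff_convergesContinuously hprim,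
    tendstoLocallyUniformly_iff_forall_isCompact]
  intro K hK
  rw [Metric.tendstoUniformlyOn_iff]
  intro ε hε
  obtain ⟨R, hR⟩ := hK.isBounded.exists_norm_le
  have hR' : 0 < |R| + 1 := by positivity
  have hu := (tendstoLocallyUniformly_iff_forall_isCompact.1
    ((tendstoLocallyUniformly_iff_convergesContinuously hf).2 h)) (Icc (-|R|) |R|) isCompact_Icc
  rw [Metric.tendstoUniformlyOn_iff] at hu
  filter_upwards [hu (ε / (|R| + 1)) (by positivity), hF] with n hn hFn x hx
  have hxR : |x| ≤ |R| := (hR x hx).trans (le_abs_self R)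
  rw [Real.dist_eq, ← intervalIntegral.integral_sub (hf.intervalIntegrable _ _)
    (hFn.intervalIntegrable _ _), ← Real.norm_eq_abs]
  have hb := intervalIntegral.norm_integral_le_of_norm_le_const (a := 0) (b := x)
    (f := fun t => f t - F n t) (C := ε / (|R| + 1)) fun t ht => by
      refine (hn t ?_).le
      have hsub : uIoc 0 x ⊆ Icc (-|R|) |R| := by
        refine uIoc_subset_uIcc.trans (uIcc_subset_Icc ?_ ?_)
        · exact ⟨by linarith [abs_nonneg R], abs_nonneg R⟩
        · exact abs_le.1 hxR
      exact hsub ht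
  refine hb.trans_lt ?_
  rw [sub_zero, div_mul_eq_mul_div, div_lt_iff₀ hR']
  exact mul_lt_mul_of_pos_left (by linarith) hε

/-! ### Regularized equations -/

section Regularized

variable {s β' : ℕ → ℝ → ℝ} {p S : ℝ → ℝ}

/-- A strictly positive modification of the coefficients `s_n` converging to `p > 0`. -/
def posPart (s : ℕ → ℝ → ℝ) (p : ℝ → ℝ) (n : ℕ) (x : ℝ) : ℝ :=
  max (s n x) (p x / 2)

/-- The exponent attached to the modified coefficients. -/
def modSigma (s β' : ℕ → ℝ → ℝ) (p : ℝ → ℝ) (n : ℕ) (x : ℝ) : ℝ :=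
  2 * ∫ y in (0 : ℝ)..x, β' n y / posPart s p n y

theorem posPart_pos (hp : ∀ x, 0 < p x) (n : ℕ) (x : ℝ) : 0 < posPart s p n x :=
  lt_max_of_lt_right (half_pos (hp x))

theorem continuous_posPart (hpc : Continuous p) {n : ℕ} (hs : Continuous (s n)) :
    Continuous (posPart s p n) :=
  hs.max (hpc.div_const 2)

/-- Mollifiers may change sign, so `s n` may fail to be positive far out; on each bounded set the
modification eventually has no effect. -/
theorem eventually_posPart_eq (hpc : Continuous p) (hp : ∀ x, 0 < p x)
    (hs : ConvergesContinuously s p) (R : ℝ) :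
    ∀ᶠ n in atTop, ∀ x, |x| ≤ R → posPart s p n x = s n x := by
  have h1 : ∀ x, ∀ᶠ q : ℕ × ℝ in atTop ×ˢ 𝓝 x, p q.2 / 2 < s q.1 q.2 := fun x =>
    Tendsto.eventually_lt (((hpc.div_const 2).tendsto x).comp tendsto_snd) (hs x)
      (half_lt_self (hp x))
  filter_upwards [IsCompact.eventually_forall_of_prod (isCompact_Icc (a := -R) (b := R))
    (P := fun n x => p x / 2 < s n x) h1] with n hn x hx
  exact max_eq_left (hn x (abs_le.1 hx)).le

theorem convergesContinuously_posPart (hpc : Continuous p) (hp : ∀ x, 0 < p x)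
    (hs : ConvergesContinuously s p) : ConvergesContinuously (posPart s p) p := by
  intro x
  have h1 := (hs x).max (((hpc.div_const 2).tendsto x).comp tendsto_snd)
  rwa [max_eq_left (half_lt_self (hp x)).le] at h1

theorem convergesContinuously_modSigma (hpc : Continuous p) (hp : ∀ x, 0 < p x)
    (hs : ConvergesContinuously s p)
    (hS : ConvergesContinuously (fun n x => 2 * ∫ y in (0 : ℝ)..x, β' n y / s n y) S) :
    ConvergesContinuously (modSigma s β' p) S := by
  intro x
  refine (hS x).congr' ?_
  refine eventually_prod_of_forall_abs_le
    (P := fun n x => 2 * ∫ y in (0 : ℝ)..x, β' n y / s n y = modSigma s β' p n x)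
    (fun R => ?_) x
  filter_upwards [eventually_posPart_eq hpc hp hs R] with n hn y hy
  rw [modSigma]
  congr 1
  refine intervalIntegral.integral_congr fun t ht => ?_
  rw [hn t ((abs_le.2 ?_ : |t| ≤ |y|).trans hy)]
  exact uIcc_subset_Icc ⟨by simp, by simp⟩ (abs_le.1 le_rfl) ht

theorem hasDerivAt_modSigma (hpc : Continuous p) (hp : ∀ x, 0 < p x) {n : ℕ}
    (hs : Continuous (s n)) (hβ : Continuous (β' n)) (x : ℝ) :
    HasDerivAt (modSigma s β' p n) (2 * (β' n x / posPart s p n x)) x := by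
  have hc : Continuous fun y => β' n y / posPart s p n y :=
    hβ.div (continuous_posPart hpc hs) fun y => (posPart_pos hp n y).ne'
  exact (hc.integral_hasStrictDerivAt 0 x).hasDerivAt.const_mul 2

/-- Limits of solutions of the regularized equations solve the limit equation in divergence
form. -/
theorem hasDerivAt_of_regularized (hpc : Continuous p) (hp : ∀ x, 0 < p x)
    (hsc : ∀ n, 1 ≤ n → Continuous (s n)) (hβc : ∀ n, 1 ≤ n → Continuous (β' n))
    (hs : ConvergesContinuously s p) (hSc : Continuous S)
    (hS : ConvergesContinuously (fun n x => 2 * ∫ y in (0 : ℝ)..x, β' n y / s n y) S)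
    {g l : ℝ → ℝ} {gn ln : ℕ → ℝ → ℝ} (hlc : Continuous l)
    (hgn : ∀ n, 1 ≤ n → ContDiff ℝ 1 (gn n)) (hln : ∀ n, 1 ≤ n → Continuous (ln n))
    (heq : ∀ n, 1 ≤ n → ∀ x, s n x / 2 * deriv (gn n) x + β' n x * gn n x = ln n x)
    (hg : ConvergesContinuously gn g) (hl : ConvergesContinuously ln l) (x : ℝ) :
    HasDerivAt (fun x => g x * Real.exp (S x)) (2 * l x * Real.exp (S x) / p x) x := by
  have hSg := convergesContinuously_modSigma hpc hp hs hS
  have hpp := convergesContinuously_posPart hpc hp hs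
  have hexp : ConvergesContinuously (fun n x => Real.exp (modSigma s β' p n x))
      fun x => Real.exp (S x) := fun x =>
    (Real.continuous_exp.tendsto _).comp (hSg x)
  have hSgc : ∀ n, 1 ≤ n → Continuous (modSigma s β' p n) := fun n hn =>
    continuous_iff_continuousAt.2 fun x =>
      (hasDerivAt_modSigma hpc hp (hsc n hn) (hβc n hn) x).continuousAt
  have hic : ∀ n, 1 ≤ n →
      Continuous fun t => 2 * ln n t * Real.exp (modSigma s β' p n t) / posPart s p n t :=
    fun n hn => ((continuous_const.mul (hln n hn)).mul (Real.continuous_exp.comp (hSgc n hn))).div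
      (continuous_posPart hpc (hsc n hn)) fun y => (posPart_pos hp n y).ne'
  have hlimc : Continuous fun t => 2 * l t * Real.exp (S t) / p t :=
    ((continuous_const.mul hlc).mul (Real.continuous_exp.comp hSc)).div hpc fun y => (hp y).ne'
  have hint : ConvergesContinuously
      (fun n t => 2 * ln n t * Real.exp (modSigma s β' p n t) / posPart s p n t)
      fun t => 2 * l t * Real.exp (S t) / p t := fun t =>
    (((hl t).const_mul 2).mul (hexp t)).div (hpp t) (hp t).ne'
  have hprim := hint.integral (eventually_atTop.2 ⟨1, hic⟩) hlimc
  -- The equation times the integrating factor is integrated before passing to the limit, since no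
  -- convergence of `β'` or of the derivatives of `gn` is available.
  have hid : ∀ x, g x * Real.exp (S x) =
      g 0 * Real.exp (S 0) + ∫ t in (0 : ℝ)..x, 2 * l t * Real.exp (S t) / p t := by
    intro x
    have hL : Tendsto (fun n => gn n x * Real.exp (modSigma s β' p n x)) atTop
        (𝓝 (g x * Real.exp (S x))) := (hg.tendsto x).mul (hexp.tendsto x)
    have hR := ((hg.tendsto 0).mul (hexp.tendsto 0)).add (hprim.tendsto x)
    refine tendsto_nhds_unique hL (hR.congr' ?_)
    filter_upwards [eventually_ge_atTop 1, eventually_posPart_eq hpc hp hs |x|] with n hn hpos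
    rw [intervalIntegral.integral_eq_sub_of_hasDerivAt
      (f := fun t => gn n t * Real.exp (modSigma s β' p n t)) (fun t ht => ?_)
      ((hic n hn).intervalIntegrable _ _)]
    · ring
    have htx : |t| ≤ |x| := abs_le.2
      (uIcc_subset_Icc ⟨by simp, by simp⟩ (abs_le.1 le_rfl) ht)
    have h1 : HasDerivAt (gn n) (deriv (gn n) t) t :=
      ((hgn n hn).differentiable one_ne_zero).differentiableAt.hasDerivAt
    have h2 := (hasDerivAt_modSigma hpc hp (hsc n hn) (hβc n hn) t).exp
    refine (h1.mul h2).congr_deriv ?_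
    have hpp0 := (posPart_pos (s := s) hp n t).ne'
    rw [hpos t htx] at hpp0 ⊢
    rw [← heq n hn t]
    field_simp
  have h1 := (hlimc.integral_hasStrictDerivAt 0 x).hasDerivAt.const_add (g 0 * Real.exp (S 0))
  exact h1.congr_of_eventuallyEq (Eventually.of_forall hid)

/-- Solutions of the limit equation in divergence form are limits of solutions of the regularized
equations. -/
theorem exists_regularized (hpc : Continuous p) (hp : ∀ x, 0 < p x)
    (hsc : ∀ n, 1 ≤ n → Continuous (s n)) (hβc : ∀ n, 1 ≤ n → Continuous (β' n))
    (hs : ConvergesContinuously s p) (hSc : Continuous S)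
    (hS : ConvergesContinuously (fun n x => 2 * ∫ y in (0 : ℝ)..x, β' n y / s n y) S)
    {f l : ℝ → ℝ} (hf : ContDiff ℝ 1 f) (hlc : Continuous l)
    (hfl : ∀ x, HasDerivAt (fun x => deriv f x * Real.exp (S x))
      (2 * l x * Real.exp (S x) / p x) x) :
    ∃ fn : ℕ → ℝ → ℝ, (∀ n, 1 ≤ n → ContDiff ℝ 2 (fn n)) ∧ ConvergesContinuously fn f ∧
      ConvergesContinuously (fun n => deriv (fn n)) (deriv f) ∧
      ConvergesContinuously
        (fun n x => s n x / 2 * deriv (deriv (fn n)) x + β' n x * deriv (fn n) x) l := by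
  have hf'c : Continuous (deriv f) := hf.continuous_deriv le_rfl
  have hSg := convergesContinuously_modSigma hpc hp hs hS
  have hpp := convergesContinuously_posPart hpc hp hs
  have hexp : ConvergesContinuously (fun n x => Real.exp (modSigma s β' p n x))
      fun x => Real.exp (S x) := fun x =>
    (Real.continuous_exp.tendsto _).comp (hSg x)
  have hSgc : ∀ n, 1 ≤ n → Continuous (modSigma s β' p n) := fun n hn =>
    continuous_iff_continuousAt.2 fun x =>
      (hasDerivAt_modSigma hpc hp (hsc n hn) (hβc n hn) x).continuousAt
  have hic : ∀ n, 1 ≤ n →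
      Continuous fun t => 2 * l t * Real.exp (modSigma s β' p n t) / posPart s p n t :=
    fun n hn => ((continuous_const.mul hlc).mul (Real.continuous_exp.comp (hSgc n hn))).div
      (continuous_posPart hpc (hsc n hn)) fun y => (posPart_pos hp n y).ne'
  have hlimc : Continuous fun t => 2 * l t * Real.exp (S t) / p t :=
    ((continuous_const.mul hlc).mul (Real.continuous_exp.comp hSc)).div hpc fun y => (hp y).ne'
  have hint : ConvergesContinuously
      (fun n t => 2 * l t * Real.exp (modSigma s β' p n t) / posPart s p n t)
      fun t => 2 * l t * Real.exp (S t) / p t := fun t =>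
    (((((hlc.tendsto t).comp tendsto_snd).const_mul 2).mul (hexp t)).div (hpp t) (hp t).ne')
  have hprim := hint.integral (eventually_atTop.2 ⟨1, hic⟩) hlimc
  set c := deriv f 0 * Real.exp (S 0) with hc
  set I : ℕ → ℝ → ℝ := fun n x =>
    ∫ t in (0 : ℝ)..x, 2 * l t * Real.exp (modSigma s β' p n t) / posPart s p n t with hI
  -- Variation of constants for the equation with modified coefficients and right-hand side `l`,
  -- started from the limit's flux at `0`.
  set gn : ℕ → ℝ → ℝ := fun n x => Real.exp (-modSigma s β' p n x) * (c + I n x) with hgn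
  have hgd : ∀ n, 1 ≤ n → ∀ x, HasDerivAt (gn n)
      (2 * l x / posPart s p n x - 2 * (β' n x / posPart s p n x) * gn n x) x := by
    intro n hn x
    have h1 := (hasDerivAt_modSigma hpc hp (hsc n hn) (hβc n hn) x).neg.exp
    have h2 : HasDerivAt (I n) _ x := ((hic n hn).integral_hasStrictDerivAt 0 x).hasDerivAt
    refine (h1.mul (h2.const_add c)).congr_deriv ?_
    simp only [hgn, Pi.neg_apply]
    have := (posPart_pos (s := s) hp n x).ne'
    rw [Real.exp_neg]
    have := (Real.exp_pos (modSigma s β' p n x)).ne'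
    field_simp
    ring
  have hgc : ∀ n, 1 ≤ n → Continuous (gn n) := fun n hn =>
    continuous_iff_continuousAt.2 fun x => (hgd n hn x).continuousAt
  have hg1 : ∀ n, 1 ≤ n → ContDiff ℝ 1 (gn n) := by
    intro n hn
    rw [contDiff_one_iff_deriv]
    refine ⟨fun x => (hgd n hn x).differentiableAt, ?_⟩
    have hpc' := continuous_posPart hpc (hsc n hn)
    have hb := hβc n hn
    have hg := hgc n hn
    have hne : ∀ y, posPart s p n y ≠ 0 := fun y => (posPart_pos hp n y).ne'
    rw [funext fun x => (hgd n hn x).deriv]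
    fun_prop (disch := exact hne _)
  have hgconv : ConvergesContinuously gn (deriv f) := by
    intro x
    have h1 : Tendsto (fun q : ℕ × ℝ => gn q.1 q.2) (atTop ×ˢ 𝓝 x) (𝓝 (Real.exp (-S x) *
        (c + ∫ t in (0 : ℝ)..x, 2 * l t * Real.exp (S t) / p t))) :=
      ((Real.continuous_exp.tendsto _).comp (hSg x).neg).mul ((hprim x).const_add c)
    convert h1 using 2
    rw [intervalIntegral.integral_eq_sub_of_hasDerivAt (fun t _ => hfl t)
      (hlimc.intervalIntegrable _ _), hc, add_sub_cancel, Real.exp_neg]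
    have := (Real.exp_pos (S x)).ne'
    field_simp
  have hfd : ∀ n, 1 ≤ n → ∀ x, HasDerivAt (fun x => f 0 + ∫ t in (0 : ℝ)..x, gn n t) (gn n x) x :=
    fun n hn x => ((hgc n hn).integral_hasStrictDerivAt 0 x).hasDerivAt.const_add (f 0)
  have hderiv : ∀ n, 1 ≤ n → deriv (fun x => f 0 + ∫ t in (0 : ℝ)..x, gn n t) = gn n :=
    fun n hn => funext fun x => (hfd n hn x).deriv
  have hev : ∀ x : ℝ, ∀ᶠ q : ℕ × ℝ in atTop ×ˢ 𝓝 x, 1 ≤ q.1 := fun x =>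
    tendsto_fst.eventually (eventually_ge_atTop 1)
  refine ⟨fun n x => f 0 + ∫ t in (0 : ℝ)..x, gn n t, fun n hn => ?_, fun x => ?_, fun x => ?_,
    fun x => ?_⟩
  · rw [show (2 : WithTop ℕ∞) = 1 + 1 by norm_num, contDiff_succ_iff_deriv]
    refine ⟨fun x => (hfd n hn x).differentiableAt, by simp, ?_⟩
    rw [hderiv n hn]
    exact hg1 n hn
  · have h1 := ((hgconv.integral (eventually_atTop.2 ⟨1, hgc⟩) hf'c) x).const_add (f 0)
    simp only at h1
    rwa [intervalIntegral.integral_deriv_eq_sub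
      (fun t _ => (hf.differentiable one_ne_zero).differentiableAt)
      (hf'c.intervalIntegrable _ _), add_sub_cancel] at h1
  · refine (hgconv x).congr' ?_
    filter_upwards [hev x] with q hq
    simp only [hderiv q.1 hq]
  -- With the unmodified coefficients the right-hand side equals `l` only on bounded sets and for
  -- large `n`, which is enough for the limit.
  · refine ((hlc.tendsto x).comp tendsto_snd).congr' ?_
    filter_upwards [hev x, eventually_prod_of_forall_abs_le
      (P := fun n x => posPart s p n x = s n x) (eventually_posPart_eq hpc hp hs) x] with q hq hpos
    simp only [hderiv q.1 hq, Function.comp_apply]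
    have h0 := (posPart_pos (s := s) hp q.1 q.2).ne'
    rw [(hgd q.1 hq q.2).deriv]
    rw [hpos] at h0 ⊢
    field_simp
    ring

end Regularized

/-! ### Equivalence of $C^1$-solutions with the divergence form -/

/-- `C¹`-solutions of `L f = l` are the solutions of `(f' e^Σ)' = 2 l e^Σ / σ²`. -/
theorem exists_isC1Solution_iff {σ β : ℝ → ℝ} (hσ : Continuous σ) (hβ : Continuous β)
    (hσ_pos : ∀ x, 0 < σ x) (hreg : RegularizationsExist σ β) (hSigma : SigmaExists σ β) :
    ∃ S : ℝ → ℝ, Continuous S ∧ ∀ f l : ℝ → ℝ, IsC1Solution σ β f l ↔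
      ContDiff ℝ 1 f ∧ Continuous l ∧ ∀ x, HasDerivAt (fun x => deriv f x * Real.exp (S x))
        (2 * l x * Real.exp (S x) / σ x ^ 2) x := by
  obtain ⟨S, hSc, hS⟩ := hSigma
  have hpc : Continuous fun x => σ x ^ 2 := hσ.pow 2
  have hp : ∀ x, 0 < σ x ^ 2 := fun x => pow_pos (hσ_pos x) 2
  obtain ⟨N, hN, hσN⟩ := exists_integrable_div_pow hpc
    (integrable_mul_schwartz fun Φ hΦ => (hreg Φ hΦ 1 le_rfl).1)
  obtain ⟨M, -, hβM⟩ := exists_integrable_div_pow hβ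
    (integrable_mul_schwartz fun Φ hΦ => (hreg Φ hΦ 1 le_rfl).2)
  have hsc : ∀ (Φ : 𝓢(ℝ, ℝ)) n, 1 ≤ n → Continuous (mollify (fun y => σ y ^ 2) Φ n) :=
    fun Φ n hn => continuous_mollify hpc hσN Φ hn
  have hβc : ∀ (Φ : 𝓢(ℝ, ℝ)) n, 1 ≤ n → Continuous (deriv (mollify β Φ n)) :=
    fun Φ n hn => continuous_deriv_mollify hβ hβM Φ hn
  have hs : ∀ Φ : 𝓢(ℝ, ℝ), IsMollifier Φ →
      ConvergesContinuously (mollify (fun y => σ y ^ 2) Φ) fun x => σ x ^ 2 :=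
    fun Φ hΦ => tendsto_mollify hpc hN hσN hΦ
  have hS' : ∀ Φ : 𝓢(ℝ, ℝ), IsMollifier Φ → ConvergesContinuously (regSigma σ β Φ) S :=
    fun Φ hΦ => (tendstoLocallyUniformly_iff_convergesContinuously hSc).1 (hS Φ hΦ)
  refine ⟨S, hSc, fun f l => ⟨fun ⟨hf, hl, h⟩ => ⟨hf, hl, ?_⟩, fun ⟨hf, hl, h⟩ =>
    ⟨hf, hl, fun Φ hΦ => ?_⟩⟩⟩
  -- A single mollifier suffices here, because `S` does not depend on it.
  · obtain ⟨Φ, hΦ⟩ := exists_isMollifier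
    obtain ⟨fn, ln, hfl, -, hf', hl'⟩ := h Φ hΦ
    refine hasDerivAt_of_regularized hpc hp (hsc Φ) (hβc Φ) (hs Φ hΦ) hSc (hS' Φ hΦ) hl
      (gn := fun n => deriv (fn n)) (fun n hn => ?_) (fun n hn => (hfl n hn).2.1)
      (fun n hn x => congrFun (hfl n hn).2.2 x)
      ((tendstoLocallyUniformly_iff_convergesContinuously (hf.continuous_deriv le_rfl)).1 hf')
      ((tendstoLocallyUniformly_iff_convergesContinuously hl).1 hl')
    have := (hfl n hn).1
    rw [show (2 : WithTop ℕ∞) = 1 + 1 by norm_num, contDiff_succ_iff_deriv] at this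
    exact this.2.2
  · obtain ⟨fn, h2, h3, h4, h5⟩ := exists_regularized hpc hp (hsc Φ) (hβc Φ) (hs Φ hΦ) hSc
      (hS' Φ hΦ) hf hl h
    refine ⟨fn, fun n => regL σ β Φ n (fn n), fun n hn => ⟨h2 n hn, ?_, rfl⟩,
      (tendstoLocallyUniformly_iff_convergesContinuously hf.continuous).2 h3,
      (tendstoLocallyUniformly_iff_convergesContinuously (hf.continuous_deriv le_rfl)).2 h4,
      (tendstoLocallyUniformly_iff_convergesContinuously hl).2 h5⟩
    have hd := h2 n hn
    rw [show (2 : WithTop ℕ∞) = 1 + 1 by norm_num, contDiff_succ_iff_deriv] at hd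
    have h1 := hd.2.2.continuous
    have h2 := hd.2.2.continuous_deriv le_rfl
    have h3 := hsc Φ n hn
    have h4 := hβc Φ n hn
    unfold regL
    fun_prop

/-! ### Maximum principle and the boundary value problem -/

/-- If `e(x₀) ≥ 0` and `e' ≥ -K |e|`, then `e` stays nonnegative. -/
theorem nonneg_of_neg_mul_abs_le_deriv {e e' : ℝ → ℝ} {x₀ x₁ K : ℝ}
    (he : ∀ x ∈ Icc x₀ x₁, HasDerivAt e (e' x) x) (h0 : 0 ≤ e x₀)
    (hb : ∀ x ∈ Ico x₀ x₁, -(K * |e x|) ≤ e' x) : ∀ x ∈ Icc x₀ x₁, 0 ≤ e x := by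
  intro x hx
  -- The rate `K + 1` instead of `K` makes the barrier's derivative strictly larger at any point of
  -- contact.
  have key : ∀ ε > 0, -e x ≤ ε * Real.exp ((K + 1) * (x - x₀)) := by
    intro ε hε
    refine image_le_of_deriv_right_lt_deriv_boundary (f := fun x => -e x) (f' := fun x => -e' x)
      (a := x₀) (b := x₁) (B := fun x => ε * Real.exp ((K + 1) * (x - x₀)))
      (B' := fun x => ε * (Real.exp ((K + 1) * (x - x₀)) * (K + 1)))
      (fun y hy => (he y hy).neg.continuousAt.continuousWithinAt)
      (fun y hy => (he y ⟨hy.1, hy.2.le⟩).neg.hasDerivWithinAt) ?_ (fun y => ?_)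
      (fun y hy hey => ?_) hx
    · simp; linarith
    · have h1 : HasDerivAt (fun x => (K + 1) * (x - x₀)) (K + 1) y := by
        simpa using ((hasDerivAt_id y).sub_const x₀).const_mul (K + 1)
      exact h1.exp.const_mul ε
    · have hpos : 0 < ε * Real.exp ((K + 1) * (y - x₀)) := by positivity
      have h1 := hb y hy
      rw [abs_of_neg (by linarith), hey] at h1
      nlinarith
  by_contra! hneg
  have hE := Real.exp_pos ((K + 1) * (x - x₀))
  have := key (-e x / (2 * Real.exp ((K + 1) * (x - x₀)))) (div_pos (by linarith) (by positivity))
  rw [div_mul_eq_mul_div, le_div_iff₀ (by positivity)] at this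
  nlinarith

/-- At a positive interior maximum the flux `e` vanishes. Up to the next point where `d ≤ 0`, the
differential inequality keeps `e` nonnegative, so `d` cannot decrease and never gets there,
contradicting `d b = 0`. -/
theorem nonpos_of_maximum_principle {a b K : ℝ} {d e e' r : ℝ → ℝ}
    (hr : ∀ x, 0 < r x) (hd : ∀ x, HasDerivAt d (r x * e x) x) (he : ∀ x, HasDerivAt e (e' x) x)
    (hda : d a = 0) (hdb : d b = 0) (hb : ∀ x ∈ Icc a b, 0 < d x → -(K * |e x|) ≤ e' x) :
    ∀ x ∈ Icc a b, d x ≤ 0 := by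
  intro y hy
  by_contra! hypos
  have hdc : Continuous d := continuous_iff_continuousAt.2 fun x => (hd x).continuousAt
  obtain ⟨x₀, hx₀, hmax⟩ := isCompact_Icc.exists_isMaxOn ⟨y, hy⟩ hdc.continuousOn
  have hx₀pos : 0 < d x₀ := hypos.trans_le (hmax hy)
  have hx₀a : a < x₀ := lt_of_le_of_ne hx₀.1 fun h => by rw [← h, hda] at hx₀pos; exact hx₀pos.false
  have hx₀b : x₀ < b := lt_of_le_of_ne hx₀.2 fun h => by rw [h, hdb] at hx₀pos; exact hx₀pos.false
  have he₀ : e x₀ = 0 := by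
    have h1 := (hmax.isLocalMax (Icc_mem_nhds hx₀a hx₀b)).hasDerivAt_eq_zero (hd x₀)
    exact (mul_eq_zero.1 h1).resolve_left (hr x₀).ne'
  have hcpt : IsCompact (Icc x₀ b ∩ {x | d x ≤ 0}) :=
    isCompact_Icc.inter_right (isClosed_le hdc continuous_const)
  obtain ⟨x₁, ⟨hx₁, hdx₁⟩, hleast⟩ := hcpt.exists_isLeast ⟨b, ⟨hx₀b.le, le_rfl⟩, hdb.le⟩
  have hpos : ∀ x ∈ Ico x₀ x₁, 0 < d x := by
    intro x hx
    by_contra! h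
    exact (hleast ⟨⟨hx.1, hx.2.le.trans hx₁.2⟩, h⟩).not_gt hx.2
  have henn := nonneg_of_neg_mul_abs_le_deriv (x₀ := x₀) (x₁ := x₁) (fun x _ => he x) he₀.ge
    fun x hx => hb x ⟨hx₀.1.trans hx.1, hx.2.le.trans hx₁.2⟩ (hpos x hx)
  have hmono : MonotoneOn d (Icc x₀ x₁) := by
    refine monotoneOn_of_deriv_nonneg (convex_Icc _ _) hdc.continuousOn
      (fun x _ => (hd x).differentiableAt.differentiableWithinAt) fun x hx => ?_
    rw [(hd x).deriv]
    exact mul_nonneg (hr x).le (henn x (interior_subset hx))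
  have := hmono ⟨le_rfl, hx₁.1⟩ ⟨hx₁.1, le_rfl⟩ hx₁.1
  have h2 : d x₁ ≤ 0 := hdx₁
  linarith

theorem eqOn_Icc_of_hasDerivWithinAt {a b : ℝ} {f g f' : ℝ → ℝ}
    (hf : ∀ x ∈ Icc a b, HasDerivWithinAt f (f' x) (Icc a b) x)
    (hg : ∀ x ∈ Icc a b, HasDerivWithinAt g (f' x) (Icc a b) x) (h0 : f a = g a) :
    EqOn f g (Icc a b) := by
  intro x hx
  have h1 : ∀ x ∈ Icc a b, HasDerivWithinAt (fun x => f x - g x) 0 (Icc a b) x := fun x hx => by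
    have := (hf x hx).sub (hg x hx)
    rwa [sub_self] at this
  have h2 := constant_of_has_deriv_right_zero (fun x hx => (h1 x hx).continuousWithinAt)
    (fun x hx => (h1 x ⟨hx.1, hx.2.le⟩).mono_of_mem_nhdsWithin (Icc_mem_nhdsGE_of_mem hx)) x hx
  rw [h0, sub_self] at h2
  exact sub_eq_zero.1 h2

theorem derivWithin_eq_deriv_of_eqOn_Icc {a b : ℝ} (hab : a < b) {f g : ℝ → ℝ}
    (hf : Differentiable ℝ f) (h : EqOn f g (Icc a b)) {x : ℝ} (hx : x ∈ Icc a b) :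
    derivWithin g (Icc a b) x = deriv f x := by
  rw [← derivWithin_congr h (h hx)]
  exact hf.differentiableAt.derivWithin (uniqueDiffOn_Icc hab x hx)

/-- Two solutions of the boundary value problem are ordered. -/
theorem IsBVPSolution.le {σ β : ℝ → ℝ} (hσ : Continuous σ) (hσ_pos : ∀ x, 0 < σ x) {S : ℝ → ℝ}
    (hS : ∀ f l : ℝ → ℝ, IsC1Solution σ β f l ↔
      ContDiff ℝ 1 f ∧ Continuous l ∧ ∀ x, HasDerivAt (fun x => deriv f x * Real.exp (S x))
        (2 * l x * Real.exp (S x) / σ x ^ 2) x)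
    {a b A B k : ℝ} (hab : a < b) {F : ℝ → ℝ → ℝ → ℝ}
    (hmono : ∀ x ∈ Icc a b, ∀ y y' z : ℝ, 0 ≤ (F x y z - F x y' z) * (y - y'))
    (hlip : ∀ x ∈ Icc a b, ∀ y z z' : ℝ, |F x y z - F x y z'| ≤ k * |z - z'|) {u v : ℝ → ℝ}
    (hu : IsBVPSolution σ β a b A B F u) (hv : IsBVPSolution σ β a b A B F v) :
    ∀ x ∈ Icc a b, u x ≤ v x := by
  obtain ⟨-, gu, ut, hgu, hut, hsu, hua, hub⟩ := hu
  obtain ⟨-, gv, vt, hgv, hvt, hsv, hva, hvb⟩ := hv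
  obtain ⟨hu1, -, hu2⟩ := (hS _ _).1 hsu
  obtain ⟨hv1, -, hv2⟩ := (hS _ _).1 hsv
  have hud := hu1.differentiable one_ne_zero
  have hvd := hv1.differentiable one_ne_zero
  have hcont : Continuous fun x => 2 * |k| / σ x ^ 2 :=
    continuous_const.div (hσ.pow 2) fun x => (pow_pos (hσ_pos x) 2).ne'
  obtain ⟨K, hK⟩ := (isCompact_Icc (a := a) (b := b)).exists_bound_of_continuousOn
    hcont.continuousOn
  have key := nonpos_of_maximum_principle (a := a) (b := b) (K := K)
    (d := fun x => ut x - vt x) (r := fun x => Real.exp (-S x))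
    (e := fun x => deriv ut x * Real.exp (S x) - deriv vt x * Real.exp (S x))
    (fun x => Real.exp_pos _) (fun x => ?_) (fun x => (hu2 x).sub (hv2 x))
    (by simp only [hua, hva, sub_self]) (by simp only [hub, hvb, sub_self]) (fun x hx hpos => ?_)
  · intro x hx
    have := key x hx
    rw [← hut hx, ← hvt hx]
    linarith
  · refine (hud.differentiableAt.hasDerivAt.sub hvd.differentiableAt.hasDerivAt).congr_deriv ?_
    rw [Real.exp_neg]
    field_simp
  · rw [hgu hx, hgv hx]
    simp only
    rw [derivWithin_eq_deriv_of_eqOn_Icc hab hud hut hx,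
      derivWithin_eq_deriv_of_eqOn_Icc hab hvd hvt hx, ← hut hx, ← hvt hx]
    have hE := Real.exp_pos (S x)
    have hσ2 := pow_pos (hσ_pos x) 2
    -- The difference of the right-hand sides is split by changing first `y`, where monotonicity
    -- applies as `d > 0`, and then `z`, where the Lipschitz bound applies.
    have h1 : 0 ≤ F x (ut x) (deriv ut x) - F x (vt x) (deriv ut x) :=
      nonneg_of_mul_nonneg_left (hmono x hx _ _ _) hpos
    have h2 : -(|k| * |deriv ut x - deriv vt x|) ≤
        F x (vt x) (deriv ut x) - F x (vt x) (deriv vt x) := by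
      have e1 := neg_le_of_abs_le (hlip x hx (vt x) (deriv ut x) (deriv vt x))
      have e2 : k * |deriv ut x - deriv vt x| ≤ |k| * |deriv ut x - deriv vt x| :=
        mul_le_mul_of_nonneg_right (le_abs_self k) (abs_nonneg _)
      linarith
    have h3 : 2 * |k| / σ x ^ 2 ≤ K := (le_abs_self _).trans (hK x hx)
    have h4 : |deriv ut x * Real.exp (S x) - deriv vt x * Real.exp (S x)| =
        |deriv ut x - deriv vt x| * Real.exp (S x) := by
      rw [← sub_mul, abs_mul, abs_of_pos hE]
    rw [h4]
    calc -(K * (|deriv ut x - deriv vt x| * Real.exp (S x)))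
        ≤ -(2 * |k| / σ x ^ 2 * (|deriv ut x - deriv vt x| * Real.exp (S x))) :=
          neg_le_neg (mul_le_mul_of_nonneg_right h3 (by positivity))
      _ = 2 * Real.exp (S x) / σ x ^ 2 * -(|k| * |deriv ut x - deriv vt x|) := by ring
      _ ≤ 2 * Real.exp (S x) / σ x ^ 2 *
          (F x (ut x) (deriv ut x) - F x (vt x) (deriv vt x)) :=
          mul_le_mul_of_nonneg_left (by linarith) (by positivity)
      _ = _ := by ring

/-- Existence for the boundary value problem. -/
theorem exists_isBVPSolution {σ β : ℝ → ℝ} (hσ : Continuous σ) (hσ_pos : ∀ x, 0 < σ x) {S : ℝ → ℝ}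
    (hSc : Continuous S) (hS : ∀ f l : ℝ → ℝ, IsC1Solution σ β f l ↔
      ContDiff ℝ 1 f ∧ Continuous l ∧ ∀ x, HasDerivAt (fun x => deriv f x * Real.exp (S x))
        (2 * l x * Real.exp (S x) / σ x ^ 2) x)
    {a b C k : ℝ} (hab : a < b) {F : ℝ → ℝ → ℝ → ℝ}
    (hF : ContinuousOn (fun p : ℝ × ℝ × ℝ => F p.1 p.2.1 p.2.2) (Icc a b ×ˢ univ))
    (hgrowth : ∀ x ∈ Icc a b, ∀ y : ℝ, |F x y 0| ≤ C * (1 + |y|))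
    (hmono : ∀ x ∈ Icc a b, ∀ y y' z : ℝ, 0 ≤ (F x y z - F x y' z) * (y - y'))
    (hlip : ∀ x ∈ Icc a b, ∀ y z z' : ℝ, |F x y z - F x y z'| ≤ k * |z - z'|) (A B : ℝ) :
    ∃ u, IsBVPSolution σ β a b A B F u := by
  -- Nothing is known about `F` off `[a, b]`; clamping `x` gives coefficients on the whole line with
  -- global bounds.
  set P : ℝ → ℝ := fun x => projIcc a b hab.le x with hP
  have hPc : Continuous P := continuous_subtype_val.comp continuous_projIcc
  have hPmem : ∀ x, P x ∈ Icc a b := fun x => (projIcc a b hab.le x).2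
  have hPid : ∀ x ∈ Icc a b, P x = x := fun x hx => by simp only [hP]; rw [projIcc_of_mem _ hx]
  set w : ℝ → ℝ := fun x => 2 * Real.exp (S x) / σ x ^ 2 with hw
  have hwc : Continuous w := by
    have : ∀ x, σ x ^ 2 ≠ 0 := fun x => (pow_pos (hσ_pos x) 2).ne'
    simp only [hw]
    fun_prop (disch := exact this _)
  have hw0 : ∀ x, 0 ≤ w x := fun x => by simp only [hw]; positivity
  set r : ℝ → ℝ := fun x => Real.exp (-S x) with hr
  have hrc : Continuous r := by simp only [hr]; fun_prop
  have hr0 : ∀ x, 0 < r x := fun x => Real.exp_pos _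
  have hIne : (Icc a b).Nonempty := nonempty_Icc.2 hab.le
  obtain ⟨xm, -, hxm⟩ := isCompact_Icc.exists_isMinOn hIne hrc.continuousOn
  obtain ⟨xM, -, hxM⟩ := isCompact_Icc.exists_isMaxOn hIne hrc.continuousOn
  obtain ⟨xW, -, hxW⟩ := isCompact_Icc.exists_isMaxOn hIne hwc.continuousOn
  set G : ℝ → ℝ → ℝ → ℝ := fun x y z => w (P x) * F (P x) y (r (P x) * z) with hG
  have hGc : Continuous fun p : ℝ × ℝ × ℝ => G p.1 p.2.1 p.2.2 := by
    refine (hwc.comp (hPc.comp continuous_fst)).mul ?_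
    refine hF.comp_continuous (f := fun p : ℝ × ℝ × ℝ => (P p.1, p.2.1, r (P p.1) * p.2.2))
      (by fun_prop) fun p => ⟨hPmem _, mem_univ _⟩
  have hGgrowth : ∀ x y, |G x y 0| ≤ w xW * |C| * (1 + |y|) := by
    intro x y
    simp only [hG, mul_zero]
    rw [abs_mul, abs_of_nonneg (hw0 _), mul_assoc]
    refine mul_le_mul (hxW (hPmem x)) ?_ (abs_nonneg _) (hw0 _)
    refine (hgrowth _ (hPmem x) y).trans ?_
    exact mul_le_mul_of_nonneg_right (le_abs_self C) (by positivity)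
  have hGmono : ∀ x y y' z, 0 ≤ (G x y z - G x y' z) * (y - y') := by
    intro x y y' z
    simp only [hG]
    rw [← mul_sub, mul_assoc]
    exact mul_nonneg (hw0 _) (hmono _ (hPmem x) _ _ _)
  have hGlip : ∀ x y z z', |G x y z - G x y z'| ≤ w xW * (|k| * r xM) * |z - z'| := by
    intro x y z z'
    simp only [hG]
    rw [← mul_sub, abs_mul, abs_of_nonneg (hw0 _), mul_assoc]
    refine mul_le_mul (hxW (hPmem x)) ?_ (abs_nonneg _) (hw0 _)
    refine (hlip _ (hPmem x) _ _ _).trans ?_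
    rw [← mul_sub, abs_mul, abs_of_pos (hr0 _), mul_assoc]
    have h1 : r (P x) ≤ r xM := hxM (hPmem x)
    have h2 := (hr0 (P x)).le
    gcongr
    exact le_abs_self k
  obtain ⟨u, z, hua, hub, huz⟩ := exists_system_solution hab A B (r := fun x => r (P x))
    (hrc.comp hPc) (hr0 xm) (fun x => hxm (hPmem x)) (fun x => hxM (hPmem x)) hGc
    (mul_nonneg (hw0 _) (mul_nonneg (abs_nonneg _) (hr0 _).le))
    (mul_nonneg (hw0 _) (abs_nonneg _)) hGgrowth hGmono hGlip
  have huc : Continuous fun x => u (P x) :=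
    ContinuousOn.comp_continuous (s := Icc a b) (fun x hx => (huz x hx).1.continuousWithinAt)
      hPc hPmem
  have hzc : Continuous fun x => z (P x) :=
    ContinuousOn.comp_continuous (s := Icc a b) (fun x hx => (huz x hx).2.continuousWithinAt)
      hPc hPmem
  set gt : ℝ → ℝ := fun x => F (P x) (u (P x)) (r (P x) * z (P x)) with hgt
  have hgtc : Continuous gt :=
    hF.comp_continuous (f := fun x => (P x, u (P x), r (P x) * z (P x)))
      (hPc.prodMk (huc.prodMk ((hrc.comp hPc).mul hzc))) fun x => ⟨hPmem _, mem_univ _⟩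
  -- The extensions integrate the clamped right-hand side against the unclamped `w` and `r`, so that
  -- the divergence form holds on all of the line with the true `σ` and `S`.
  set zt : ℝ → ℝ := fun x => z a + ∫ t in a..x, w t * gt t with hzt
  have hztd : ∀ x, HasDerivAt zt (w x * gt x) x := fun x =>
    ((hwc.mul hgtc).integral_hasStrictDerivAt a x).hasDerivAt.const_add (z a)
  have hztc : Continuous zt := continuous_iff_continuousAt.2 fun x => (hztd x).continuousAt
  have hzeq : EqOn z zt (Icc a b) := by
    refine eqOn_Icc_of_hasDerivWithinAt (f' := fun x => w x * gt x) (fun x hx => ?_)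
      (fun x _ => (hztd x).hasDerivWithinAt) (by simp [hzt])
    refine (huz x hx).2.congr_deriv ?_
    simp only [hG, hgt, hPid x hx]
  set ut : ℝ → ℝ := fun x => A + ∫ t in a..x, r t * zt t with hut
  have hutd : ∀ x, HasDerivAt ut (r x * zt x) x := fun x =>
    ((hrc.mul hztc).integral_hasStrictDerivAt a x).hasDerivAt.const_add A
  have hueq : EqOn ut u (Icc a b) := by
    refine eqOn_Icc_of_hasDerivWithinAt (f' := fun x => r x * zt x)
      (fun x _ => (hutd x).hasDerivWithinAt) (fun x hx => ?_) (by simp [hut, hua])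
    refine (huz x hx).1.congr_deriv ?_
    rw [← hzeq hx]
    simp only [hPid x hx]
  have hderiv : deriv ut = fun x => r x * zt x := funext fun x => (hutd x).deriv
  have hutd' : Differentiable ℝ ut := fun x => (hutd x).differentiableAt
  have hut1 : ContDiff ℝ 1 ut := by
    rw [contDiff_one_iff_deriv, hderiv]
    exact ⟨hutd', hrc.mul hztc⟩
  refine ⟨u, hut1.contDiffOn.congr fun x hx => (hueq hx).symm, gt, ut, fun x hx => ?_, hueq,
    (hS _ _).2 ⟨hut1, hgtc, fun x => ?_⟩, ?_, ?_⟩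
  · simp only
    rw [derivWithin_eq_deriv_of_eqOn_Icc hab hutd' hueq hx, hderiv]
    simp only [hgt, hPid x hx]
    rw [hzeq hx]
  · have h1 : (fun x => deriv ut x * Real.exp (S x)) = zt := by
      ext y
      rw [hderiv]
      simp only [hr, Real.exp_neg]
      field_simp
    rw [h1]
    refine (hztd x).congr_deriv ?_
    simp only [hw]
    ring
  · rw [hueq ⟨le_rfl, hab.le⟩, hua]
  · rw [hueq ⟨hab.le, le_rfl⟩, hub]

end DistributionalDrift

end

theorem corollary3p9
    (σ β : ℝ → ℝ) (hσ : Continuous σ) (hβ : Continuous β) (hσ_pos : ∀ x, 0 < σ x)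
    (hreg : DistributionalDrift.RegularizationsExist σ β)
    (hSigma : DistributionalDrift.SigmaExists σ β)
    (a b : ℝ) (hab : a < b) (F : ℝ → ℝ → ℝ → ℝ)
    (hF : ContinuousOn (fun p : ℝ × ℝ × ℝ => F p.1 p.2.1 p.2.2) (Icc a b ×ˢ univ))
    (hgrowth : ∃ C : ℝ, ∀ x ∈ Icc a b, ∀ y : ℝ, |F x y 0| ≤ C * (1 + |y|))
    (hmono : ∀ x ∈ Icc a b, ∀ y y' z : ℝ, 0 ≤ (F x y z - F x y' z) * (y - y'))
    (hlip : ∃ k : ℝ, ∀ x ∈ Icc a b, ∀ y z z' : ℝ, |F x y z - F x y z'| ≤ k * |z - z'|)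
    (A B : ℝ) :
    ∃ u : ℝ → ℝ, DistributionalDrift.IsBVPSolution σ β a b A B F u ∧
      ∀ v : ℝ → ℝ, DistributionalDrift.IsBVPSolution σ β a b A B F v →
        EqOn v u (Icc a b) := by
  obtain ⟨C, hC⟩ := hgrowth
  obtain ⟨k, hk⟩ := hlip
  obtain ⟨S, hSc, hS⟩ :=
    DistributionalDrift.exists_isC1Solution_iff hσ hβ hσ_pos hreg hSigma
  obtain ⟨u, hu⟩ := DistributionalDrift.exists_isBVPSolution hσ hσ_pos hSc hS hab hF hC hmono hk A B
  exact ⟨u, hu, fun v hv x hx => le_antisymm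
    (DistributionalDrift.IsBVPSolution.le hσ hσ_pos hS hab hmono hk hv hu x hx)
    (DistributionalDrift.IsBVPSolution.le hσ hσ_pos hS hab hmono hk hu hv x hx)⟩
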